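/- Let $d\ge 1$ and let $1\le k_1<\cdots<k_d$ be integers. For each $r\in\{1,\ldots,d\}$ let $(A_r,B_r)\in\mathbb{N}_{\ge 0}^2\setminus\{(0,0)\}$ and set $$P_r(x_r,y_r)=\sum_{i=1}^{A_r}x_{r,i}^{2^{k_r}}-\sum_{j=1}^{B_r}y_{r,j}^{2^{k_r}},\qquad f=\sum_{r=1}^d P_r\in\mathbb{R}[x_{r,i},y_{r,j}].$$ Let $\sigma^+=\sum_{r=1}^d A_r$, $\sigma^-=\sum_{r=1}^d B_r$, and let $s=\sigma^++\sigma^-$ be the number of variables. For $c\in\mathbb{R}$ write $\{f=c\}$ for the set of points of $\mathbb{R}^s$ at which $f$ takes the value $c$. For a locally compact Hausdorff space $X$ whose cohomology with compact supports $H_c^*(X;K)$, over a field $K$, is of finite total dimension, let $\chi_c(X)=\sum_{q}(-1)^q\dim_K H^q_c(X;K)$. Then, for every field $K$ (for instance $K=\mathbb{Z}/2$), the spaces $\{f=0\}$, $\{f=1\}$ and $\{f=-1\}$ have compactly supported cohomology of finite total dimension, and $$\chi_c(f=0)=(-1)^{s-1}+(-1)^{\sigma^+}+(-1)^{\sigma^-},$$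 $$\chi_c(f=1)=(-1)^{s-1}+(-1)^{\sigma^-},$$ $$\chi_c(f=-1)=(-1)^{s-1}+(-1)^{\sigma^+}.$$ -/

import Mathlib

open scoped Topology

/-! ### Cohomology with compact supports (Alexander-Spanier cochains)

For a topological space `X` and a field `K`, a `q`-cochain is an arbitrary function
`X ^ (q + 1) → K`. With `A_c` the cochains of compact support and `A_0` the cochains that vanish
near every point of the diagonal, `H_c^q(X; K)` is the `q`-th cohomology of the quotient complex
`A_c / A_0`. On locally compact Hausdorff spaces (in particular on closed subsets of `ℝ ^ s`)
this is the usual cohomology with compact supports. -/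

namespace AlexanderSpanier

/-- All `q`-cochains on `X` with values in `K`. -/
abbrev Cochain (K X : Type*) (q : ℕ) : Type _ := (Fin (q + 1) → X) → K

section

variable (K : Type*) [Field K] (X : Type*)

/-- `(δφ)(x₀, …, x_{q+1}) = ∑ i, (-1)^i φ(x₀, …, x_{i-1}, x_{i+1}, …, x_{q+1})`. -/
def delta (q : ℕ) : Cochain K X q →ₗ[K] Cochain K X (q + 1) where
  toFun φ t := ∑ i : Fin (q + 2), (-1 : K) ^ (i : ℕ) * φ (t ∘ i.succAbove)
  map_add' φ ψ := by
    funext t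
    simp [mul_add, Finset.sum_add_distrib]
  map_smul' a φ := by
    funext t
    simp [Finset.mul_sum, mul_left_comm]

variable {K X} [TopologicalSpace X]

/-- `φ` vanishes identically on `U ^ (q + 1)` for some neighbourhood `U` of `x`. -/
def VanishesNear {q : ℕ} (φ : Cochain K X q) (x : X) : Prop :=
  ∃ U ∈ 𝓝 x, ∀ t : Fin (q + 1) → X, (∀ i, t i ∈ U) → φ t = 0

/-- The support of a cochain: the (closed) set of points near which it does not vanish. -/
def supp {q : ℕ} (φ : Cochain K X q) : Set X := {x | ¬ VanishesNear φ x}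

theorem isClosed_supp {q : ℕ} (φ : Cochain K X q) : IsClosed (supp φ) := by
  rw [← isOpen_compl_iff, isOpen_iff_mem_nhds]
  intro x hx
  obtain ⟨U, hU, h⟩ := not_not.mp hx
  filter_upwards [eventually_mem_nhds_iff.mpr hU] with y hy
  exact not_not.mpr ⟨U, hy, h⟩

theorem supp_zero {q : ℕ} : supp (0 : Cochain K X q) = ∅ :=
  Set.eq_empty_of_forall_notMem fun _ hx => hx ⟨Set.univ, Filter.univ_mem, fun _ _ => rfl⟩

theorem supp_add {q : ℕ} (φ ψ : Cochain K X q) : supp (φ + ψ) ⊆ supp φ ∪ supp ψ := by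
  intro x hx
  by_contra hc
  simp only [Set.mem_union, not_or] at hc
  obtain ⟨U, hU, h⟩ := not_not.mp hc.1
  obtain ⟨V, hV, h'⟩ := not_not.mp hc.2
  exact hx ⟨U ∩ V, Filter.inter_mem hU hV, fun t ht => by
    simp [h t fun i => (ht i).1, h' t fun i => (ht i).2]⟩

theorem supp_smul {q : ℕ} (a : K) (φ : Cochain K X q) : supp (a • φ) ⊆ supp φ := by
  intro x hx hc
  obtain ⟨U, hU, h⟩ := hc
  exact hx ⟨U, hU, fun t ht => by simp [h t ht]⟩

variable (K X)

/-- `A_c^q`: the cochains with compact support. -/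
def compactCochains (q : ℕ) : Submodule K (Cochain K X q) where
  carrier := {φ | IsCompact (supp φ)}
  zero_mem' := by simp [supp_zero]
  add_mem' {φ ψ} hφ hψ := (IsCompact.union hφ hψ).of_isClosed_subset (isClosed_supp _)
    (supp_add φ ψ)
  smul_mem' a φ hφ := IsCompact.of_isClosed_subset hφ (isClosed_supp _) (supp_smul a φ)

/-- `A_0^q`: the cochains with empty support. -/
def zeroCochains (q : ℕ) : Submodule K (Cochain K X q) where
  carrier := {φ | supp φ = ∅}
  zero_mem' := supp_zero
  add_mem' {φ ψ} hφ hψ := Set.subset_empty_iff.mp <|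
    (supp_add φ ψ).trans (Set.union_subset hφ.subset hψ.subset)
  smul_mem' a φ hφ := Set.subset_empty_iff.mp <| (supp_smul a φ).trans (subset_of_eq hφ)

/-- Compactly supported cochains representing a cocycle of `A_c / A_0`. -/
def cocycles (q : ℕ) : Submodule K (Cochain K X q) :=
  compactCochains K X q ⊓ (zeroCochains K X (q + 1)).comap (delta K X q)

/-- Cochains representing a coboundary of `A_c / A_0`. -/
def coboundaries : (q : ℕ) → Submodule K (Cochain K X q)
  | 0 => zeroCochains K X 0
  | q + 1 => (compactCochains K X q).map (delta K X q) ⊔ zeroCochains K X (q + 1)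

/-- `H_c^q(X; K)`. -/
abbrev Hc (q : ℕ) : Type _ := cocycles K X q ⧸ (coboundaries K X q).submoduleOf (cocycles K X q)

/-- The total compactly supported cohomology of `X` is finite dimensional, so that `χ_c(X)` is
defined. -/
def HasFiniteHc : Prop :=
  (∀ q, Module.Finite K (Hc K X q)) ∧ ∃ N : ℕ, ∀ q, N ≤ q → Subsingleton (Hc K X q)

/-- `χ_c(X) = ∑ q, (-1)^q dim H_c^q(X; K)`; meaningful under `HasFiniteHc K X`. -/
noncomputable def chiC : ℤ := ∑ᶠ q : ℕ, (-1 : ℤ) ^ q * (Module.finrank K (Hc K X q) : ℤ)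

end

end AlexanderSpanier

/-! ### The polynomials -/

namespace Brieskorn

/-- The variables: `⟨r, Sum.inl i⟩` is `x_{r,i}` and `⟨r, Sum.inr j⟩` is `y_{r,j}`. -/
abbrev Var {d : ℕ} (A B : Fin d → ℕ) : Type := Σ r : Fin d, Fin (A r) ⊕ Fin (B r)

/-- `P_r = ∑ i, x_{r,i}^(2^{k_r}) - ∑ j, y_{r,j}^(2^{k_r})`. -/
noncomputable def P {d : ℕ} (k A B : Fin d → ℕ) (r : Fin d) : MvPolynomial (Var A B) ℝ :=
  ∑ i : Fin (A r), MvPolynomial.X ⟨r, Sum.inl i⟩ ^ 2 ^ k r -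
    ∑ j : Fin (B r), MvPolynomial.X ⟨r, Sum.inr j⟩ ^ 2 ^ k r

/-- `f = ∑ r, P_r`. -/
noncomputable def poly {d : ℕ} (k A B : Fin d → ℕ) : MvPolynomial (Var A B) ℝ :=
  ∑ r, P k A B r

/-- The fibre `{f = c}` in the real affine space of all the variables. -/
def fiber {d : ℕ} (k A B : Fin d → ℕ) (c : ℝ) : Set (Var A B → ℝ) :=
  {p | MvPolynomial.eval p (poly k A B) = c}

end Brieskorn

/-! The exponents are irrelevant up to homeomorphism: with m = 2^(k-1) - 1, the map x ↦ x|x|^m is a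
homeomorphism of the line whose square is x^(2^k). Applied coordinatewise it turns each fibre into a
quadric |x|² - |y|² = c in E × F, with dim E = σ⁺ and dim F = σ⁻ (`eval_poly`). Such a quadric has
the form |x| = ρ(y), up to exchanging E and F when c = -1, so it is E × F minus the open sets |x| >
ρ(y) and |x| < ρ(y). For ρ ≥ 0 a radial shift identifies |x| > ρ(y) with (E ∖ 0) × F, and for ρ > 0
a radial rescaling identifies |x| < ρ(y) with E × F. The formulas follow from χ_c(ℝⁿ) = (-1)ⁿ and
additivity of χ_c over a closed subset and its complement.

Additivity comes from the long exact sequence of three nested subcomplexes of cochains: those with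
empty support, those with compact support missing the closed set Z, and those with compact support.
The quotients are compared with the complexes of the complement
(`nonempty_equiv_of_isOpenEmbedding`) and of Z (`nonempty_equiv_of_retraction`). Since
Alexander-Spanier cochains are arbitrary functions, the latter needs only a retraction onto Z that
is continuous at the points of Z, and every closed subset of a metric space has one.

The value on ℝⁿ follows from additivity once X × [0, ∞) is known to be acyclic
(`subsingleton_halfSpace`): translation along the half-line pushes a compact support off itself, in
steps small enough for prism operators to preserve local vanishing. -/

open Topology

/-! ### Cohomology of subquotients of a cochain complex -/

namespace PairCohomology

section

variable {K : Type*} [Field K] {V : ℕ → Type*} [∀ q, AddCommGroup (V q)] [∀ q, Module K (V q)]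
  (d : ∀ q, V q →ₗ[K] V (q + 1)) (S T : ∀ q, Submodule K (V q))

/-- Elements of `S` representing cocycles of `S / T`. -/
def cyc (q : ℕ) : Submodule K (V q) := S q ⊓ (T (q + 1)).comap (d q)

/-- Elements representing coboundaries of `S / T`. -/
def bdry : (q : ℕ) → Submodule K (V q)
  | 0 => T 0
  | q + 1 => (S q).map (d q) ⊔ T (q + 1)

/-- The cohomology of `S / T`. -/
abbrev H (q : ℕ) : Type _ := cyc d S T q ⧸ (bdry d S T q).submoduleOf (cyc d S T q)

variable {d S T}

theorem mem_bdry_succ {q : ℕ} {v : V (q + 1)} :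
    v ∈ bdry d S T (q + 1) ↔ ∃ w ∈ S q, v - d q w ∈ T (q + 1) := by
  constructor
  · intro h
    obtain ⟨_, ⟨w, hw, rfl⟩, t, ht, rfl⟩ := Submodule.mem_sup.mp h
    exact ⟨w, hw, by simpa using ht⟩
  · rintro ⟨w, hw, ht⟩
    exact Submodule.mem_sup.mpr ⟨_, ⟨w, hw, rfl⟩, _, ht, by simp⟩

theorem le_bdry (q : ℕ) : T q ≤ bdry d S T q := by
  cases q with
  | zero => exact le_rfl
  | succ q => exact le_sup_right

theorem bdry_mono {S' T' : ∀ q, Submodule K (V q)} (hS : ∀ q, S q ≤ S' q) (hT : ∀ q, T q ≤ T' q)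
    (q : ℕ) : bdry d S T q ≤ bdry d S' T' q := by
  cases q with
  | zero => exact hT 0
  | succ q => exact sup_le_sup (Submodule.map_mono (hS q)) (hT _)

theorem subsingleton_H_iff {q : ℕ} :
    Subsingleton (H d S T q) ↔ cyc d S T q ≤ bdry d S T q := by
  rw [Submodule.Quotient.subsingleton_iff, Submodule.submoduleOf,
    Submodule.comap_subtype_eq_top]

end

/-! ### Maps between subquotients -/

section

variable {K : Type*} [Field K] {V W : Type*} [AddCommGroup V] [Module K V] [AddCommGroup W]
  [Module K W]

/-- The map of subquotients `Z / B → Z' / B'` induced by a linear map. -/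
def subquotientMap (f : V →ₗ[K] W) {Z B : Submodule K V} {Z' B' : Submodule K W}
    (hZ : ∀ v ∈ Z, f v ∈ Z') (hB : ∀ v ∈ Z, v ∈ B → f v ∈ B') :
    (Z ⧸ B.submoduleOf Z) →ₗ[K] (Z' ⧸ B'.submoduleOf Z') :=
  Submodule.mapQ _ _ (f.restrict hZ) fun v hv => hB v v.2 hv

variable {f : V →ₗ[K] W} {Z B : Submodule K V} {Z' B' : Submodule K W}
  {hZ : ∀ v ∈ Z, f v ∈ Z'} {hB : ∀ v ∈ Z, v ∈ B → f v ∈ B'}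

theorem subquotient_mk_eq_zero {v : Z} :
    (Submodule.Quotient.mk v : Z ⧸ B.submoduleOf Z) = 0 ↔ (v : V) ∈ B :=
  Submodule.Quotient.mk_eq_zero _

theorem subquotientMap_mk (v : Z) :
    subquotientMap f hZ hB (Submodule.Quotient.mk v) = Submodule.Quotient.mk ⟨f v, hZ v v.2⟩ :=
  rfl

theorem subquotientMap_injective (h : ∀ v ∈ Z, f v ∈ B' → v ∈ B) :
    Function.Injective (subquotientMap f hZ hB) := by
  rw [injective_iff_map_eq_zero]
  intro x
  obtain ⟨v, rfl⟩ := Submodule.Quotient.mk_surjective _ x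
  rw [subquotientMap_mk, subquotient_mk_eq_zero, subquotient_mk_eq_zero]
  exact h v v.2

theorem subquotientMap_surjective (h : ∀ w ∈ Z', ∃ v ∈ Z, f v - w ∈ B') :
    Function.Surjective (subquotientMap f hZ hB) := by
  intro x
  obtain ⟨w, rfl⟩ := Submodule.Quotient.mk_surjective _ x
  obtain ⟨v, hv, hvw⟩ := h w w.2
  refine ⟨Submodule.Quotient.mk ⟨v, hv⟩, ?_⟩
  rw [subquotientMap_mk, Submodule.Quotient.eq]
  exact hvw

theorem subquotientMap_exact {U : Type*} [AddCommGroup U] [Module K U] {g : W →ₗ[K] U}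
    {Z'' B'' : Submodule K U} {hZ' : ∀ v ∈ Z', g v ∈ Z''} {hB' : ∀ v ∈ Z', v ∈ B' → g v ∈ B''}
    (h₁ : ∀ v ∈ Z, g (f v) ∈ B'') (h₂ : ∀ w ∈ Z', g w ∈ B'' → ∃ v ∈ Z, f v - w ∈ B') :
    Function.Exact (subquotientMap f hZ hB) (subquotientMap g hZ' hB') := by
  intro x
  obtain ⟨w, rfl⟩ := Submodule.Quotient.mk_surjective _ x
  rw [subquotientMap_mk, subquotient_mk_eq_zero]
  constructor
  · intro hw
    obtain ⟨v, hv, hvw⟩ := h₂ w w.2 hw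
    refine ⟨Submodule.Quotient.mk ⟨v, hv⟩, ?_⟩
    rw [subquotientMap_mk, Submodule.Quotient.eq]
    exact hvw
  · rintro ⟨y, hy⟩
    obtain ⟨v, rfl⟩ := Submodule.Quotient.mk_surjective _ y
    rw [subquotientMap_mk, Submodule.Quotient.eq] at hy
    have h := hB' _ (Submodule.sub_mem _ (hZ v v.2) w.2) hy
    rw [map_sub] at h
    exact (Submodule.sub_mem_iff_right _ (h₁ v v.2)).mp h

end

/-! ### Euler characteristics and long exact sequences -/

section

variable (K : Type*) [Field K]

/-- A graded vector space of finite total dimension and Euler characteristic `n`. -/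
def HasEuler (A : ℕ → Type*) [∀ q, AddCommGroup (A q)] [∀ q, Module K (A q)] (n : ℤ) : Prop :=
  ((∀ q, Module.Finite K (A q)) ∧ ∃ N : ℕ, ∀ q, N ≤ q → Subsingleton (A q)) ∧
    ∑ᶠ q : ℕ, (-1 : ℤ) ^ q * (Module.finrank K (A q) : ℤ) = n

variable {K} {A B C : ℕ → Type*} [∀ q, AddCommGroup (A q)] [∀ q, Module K (A q)]
  [∀ q, AddCommGroup (B q)] [∀ q, Module K (B q)] [∀ q, AddCommGroup (C q)] [∀ q, Module K (C q)]

theorem HasEuler.of_equiv {n : ℤ} (e : ∀ q, A q ≃ₗ[K] B q) (h : HasEuler K A n) :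
    HasEuler K B n := by
  obtain ⟨⟨h₁, N, h₂⟩, h₃⟩ := h
  refine ⟨⟨fun q => ?_, N, fun q hq => ?_⟩, ?_⟩
  · have := h₁ q
    exact Module.Finite.equiv (e q)
  · have := h₂ q hq
    exact (e q).symm.toEquiv.subsingleton
  · rw [← h₃]
    exact finsum_congr fun q => by rw [(e q).finrank_eq]

theorem HasEuler.of_subsingleton (h : ∀ q, Subsingleton (A q)) : HasEuler K A 0 := by
  refine ⟨⟨fun q => ?_, 0, fun q _ => h q⟩, ?_⟩
  · have := h q
    infer_instance
  · rw [← finsum_zero (α := ℕ)]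
    refine finsum_congr fun q => ?_
    have := h q
    simp [Module.finrank_zero_of_subsingleton]

theorem finsum_eq_sum_range {f : ℕ → ℤ} {N : ℕ} (h : ∀ q, N ≤ q → f q = 0) :
    ∑ᶠ q, f q = ∑ q ∈ Finset.range N, f q := by
  refine finsum_eq_sum_of_support_subset _ fun q hq => ?_
  simp only [Finset.coe_range, Set.mem_Iio]
  by_contra hc
  exact hq (h q (not_lt.mp hc))

/-- A long exact sequence `0 → A 0 → B 0 → C 0 → A 1 → ⋯`. -/
structure LongExact (i : ∀ q, A q →ₗ[K] B q) (p : ∀ q, B q →ₗ[K] C q)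
    (b : ∀ q, C q →ₗ[K] A (q + 1)) : Prop where
  injective : Function.Injective (i 0)
  exact_mid : ∀ q, Function.Exact (i q) (p q)
  exact_right : ∀ q, Function.Exact (p q) (b q)
  exact_left : ∀ q, Function.Exact (b q) (i (q + 1))

theorem finite_of_exact {X Y Z : Type*} [AddCommGroup X] [Module K X] [AddCommGroup Y]
    [Module K Y] [AddCommGroup Z] [Module K Z] {f : X →ₗ[K] Y} {g : Y →ₗ[K] Z}
    (h : Function.Exact f g) [Module.Finite K X] [Module.Finite K Z] : Module.Finite K Y := by
  have h₁ : (LinearMap.ker g).FG := by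
    rw [LinearMap.exact_iff.mp h]
    exact Module.Finite.iff_fg.mp inferInstance
  exact Module.finite_def.mpr (Submodule.fg_of_fg_map_of_fg_inf_ker (s := ⊤) g
    (Module.Finite.iff_fg.mp (Module.Finite.of_injective (Submodule.subtype _)
      Subtype.val_injective)) (by simpa using h₁))

theorem subsingleton_of_exact {X Y Z : Type*} [AddCommGroup X] [Module K X] [AddCommGroup Y]
    [Module K Y] [AddCommGroup Z] [Module K Z] {f : X →ₗ[K] Y} {g : Y →ₗ[K] Z}
    (h : Function.Exact f g) [Subsingleton X] [Subsingleton Z] : Subsingleton Y := by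
  refine subsingleton_of_forall_eq 0 fun y => ?_
  obtain ⟨x, rfl⟩ := (h y).mp (Subsingleton.elim _ _)
  rw [Subsingleton.elim x 0, map_zero]

theorem finrank_eq_of_exact {X Y Z : Type*} [AddCommGroup X] [Module K X] [AddCommGroup Y]
    [Module K Y] [AddCommGroup Z] [Module K Z] {f : X →ₗ[K] Y} {g : Y →ₗ[K] Z}
    (h : Function.Exact f g) [Module.Finite K Y] :
    Module.finrank K Y =
      Module.finrank K (LinearMap.range f) + Module.finrank K (LinearMap.range g) := by
  rw [← LinearMap.finrank_range_add_finrank_ker g, LinearMap.exact_iff.mp h, add_comm]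

namespace LongExact

variable {i : ∀ q, A q →ₗ[K] B q} {p : ∀ q, B q →ₗ[K] C q} {b : ∀ q, C q →ₗ[K] A (q + 1)}

/-- Rank-nullity at each of the three spots makes the sum telescope. Cutting the sequence at N
leaves only the defect of injectivity of `i N`, which vanishes at N = 0 and again once the spaces
are zero. -/
theorem sum_eq (h : LongExact i p b) [∀ q, Module.Finite K (A q)] [∀ q, Module.Finite K (B q)]
    [∀ q, Module.Finite K (C q)] (N : ℕ) :
    ∑ q ∈ Finset.range N, (-1 : ℤ) ^ q * (Module.finrank K (A q) : ℤ) +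
      ∑ q ∈ Finset.range N, (-1 : ℤ) ^ q * (Module.finrank K (C q) : ℤ) =
    ∑ q ∈ Finset.range N, (-1 : ℤ) ^ q * (Module.finrank K (B q) : ℤ) +
      (-1 : ℤ) ^ N * ((Module.finrank K (LinearMap.range (i N)) : ℤ) -
        (Module.finrank K (A N) : ℤ)) := by
  induction N with
  | zero =>
    simp [LinearMap.finrank_range_of_inj h.injective]
  | succ N ih =>
    have h₁ := finrank_eq_of_exact (h.exact_mid N)
    have h₂ := finrank_eq_of_exact (h.exact_right N)
    have h₃ := finrank_eq_of_exact (h.exact_left N)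
    simp only [Finset.sum_range_succ, h₁, h₂, h₃, pow_succ] at ih ⊢
    push_cast
    linear_combination ih

theorem sum_eq_of_subsingleton (h : LongExact i p b) (hA : ∀ q, Module.Finite K (A q))
    (hB : ∀ q, Module.Finite K (B q)) (hC : ∀ q, Module.Finite K (C q)) {N : ℕ}
    (hA' : ∀ q, N ≤ q → Subsingleton (A q)) (hB' : ∀ q, N ≤ q → Subsingleton (B q))
    (hC' : ∀ q, N ≤ q → Subsingleton (C q)) :
    ∑ᶠ q : ℕ, (-1 : ℤ) ^ q * (Module.finrank K (A q) : ℤ) +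
      ∑ᶠ q : ℕ, (-1 : ℤ) ^ q * (Module.finrank K (C q) : ℤ) =
    ∑ᶠ q : ℕ, (-1 : ℤ) ^ q * (Module.finrank K (B q) : ℤ) := by
  rw [finsum_eq_sum_range (N := N), finsum_eq_sum_range (N := N), finsum_eq_sum_range (N := N),
    h.sum_eq N]
  · have := hA' N le_rfl
    have := hB' N le_rfl
    simp [Module.finrank_zero_of_subsingleton]
  all_goals intro q hq
  · have := hB' q hq
    simp [Module.finrank_zero_of_subsingleton]
  · have := hC' q hq
    simp [Module.finrank_zero_of_subsingleton]
  · have := hA' q hq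
    simp [Module.finrank_zero_of_subsingleton]

theorem hasEuler_right (h : LongExact i p b) {m n : ℤ} (hA : HasEuler K A m)
    (hB : HasEuler K B n) : HasEuler K C (n - m) := by
  obtain ⟨⟨hA₁, N, hA₂⟩, rfl⟩ := hA
  obtain ⟨⟨hB₁, M, hB₂⟩, rfl⟩ := hB
  have hC₁ : ∀ q, Module.Finite K (C q) := fun q => finite_of_exact (h.exact_right q)
  have hC₂ : ∀ q, max N M ≤ q → Subsingleton (C q) := fun q hq =>
    have := hA₂ (q + 1) (((le_max_left _ _).trans hq).trans (Nat.le_succ q))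
    have := hB₂ q ((le_max_right _ _).trans hq)
    subsingleton_of_exact (h.exact_right q)
  exact ⟨⟨hC₁, _, hC₂⟩, eq_sub_of_add_eq' (h.sum_eq_of_subsingleton hA₁ hB₁ hC₁
    (fun q hq => hA₂ q ((le_max_left _ _).trans hq))
    (fun q hq => hB₂ q ((le_max_right _ _).trans hq)) hC₂)⟩

theorem hasEuler_left (h : LongExact i p b) {m n : ℤ} (hB : HasEuler K B m)
    (hC : HasEuler K C n) : HasEuler K A (m - n) := by
  obtain ⟨⟨hB₁, N, hB₂⟩, rfl⟩ := hB
  obtain ⟨⟨hC₁, M, hC₂⟩, rfl⟩ := hC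
  have hA₁ : ∀ q, Module.Finite K (A q) := by
    rintro (_ | q)
    · exact Module.Finite.of_injective _ h.injective
    · exact finite_of_exact (h.exact_left q)
  -- In degree q + 1 the space sits between `C q` and `B (q + 1)`, hence the shift by one.
  have hA₂ : ∀ q, max N M + 1 ≤ q → Subsingleton (A q) := by
    rintro (_ | q) hq
    · omega
    · have := hB₂ (q + 1) (by omega)
      have := hC₂ q (by omega)
      exact subsingleton_of_exact (h.exact_left q)
  exact ⟨⟨hA₁, _, hA₂⟩, eq_sub_of_add_eq (h.sum_eq_of_subsingleton hA₁ hB₁ hC₁ hA₂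
    (fun q hq => hB₂ q (by omega)) (fun q hq => hC₂ q (by omega)))⟩

end LongExact

end

/-! ### The long exact sequence of a triple, and a comparison criterion -/

section

variable {K : Type*} [Field K] {V : ℕ → Type*} [∀ q, AddCommGroup (V q)] [∀ q, Module K (V q)]
  {d : ∀ q, V q →ₗ[K] V (q + 1)} {S R T : ∀ q, Submodule K (V q)}

/-- The complexes R/T → S/T → S/R form a short exact sequence. All three live inside the same `V`,
so two of the maps are induced by the identity. The connecting map is induced by `d` itself, because
a representative of a cocycle of S/R is its own lift to S. -/
theorem exists_longExact (hdd : ∀ q v, d (q + 1) (d q v) = 0) (hTR : ∀ q, T q ≤ R q)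
    (hRS : ∀ q, R q ≤ S q) :
    ∃ (i : ∀ q, H d R T q →ₗ[K] H d S T q) (p : ∀ q, H d S T q →ₗ[K] H d S R q)
      (b : ∀ q, H d S R q →ₗ[K] H d R T (q + 1)), LongExact i p b := by
  refine ⟨fun q => subquotientMap LinearMap.id (fun v hv => ⟨hRS q hv.1, hv.2⟩)
      (fun v _ hv => bdry_mono hRS (fun _ => le_rfl) q hv),
    fun q => subquotientMap LinearMap.id (fun v hv => ⟨hv.1, hTR _ hv.2⟩)
      (fun v _ hv => bdry_mono (fun _ => le_rfl) hTR q hv),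
    fun q => subquotientMap (d q) (fun v hv => ⟨hv.2, by simp [hdd]⟩) (fun v hv hv' => ?_),
    ?_, fun q => ?_, fun q => ?_, fun q => ?_⟩
  · cases q with
    | zero => exact mem_bdry_succ.mpr ⟨v, hv', by simp⟩
    | succ q =>
      obtain ⟨w, hw, hwv⟩ := mem_bdry_succ.mp hv'
      exact mem_bdry_succ.mpr ⟨_, hwv, by simp [hdd]⟩
  · exact subquotientMap_injective fun v _ hv => hv
  · refine subquotientMap_exact (fun v hv => le_bdry q hv.1) fun w hw hw' => ?_
    cases q with
    | zero => exact ⟨w, ⟨hw', hw.2⟩, by simp⟩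
    | succ q =>
      obtain ⟨u, hu, huw⟩ := mem_bdry_succ.mp hw'
      refine ⟨w - d q u, ⟨huw, ?_⟩, mem_bdry_succ.mpr ⟨-u, neg_mem hu, by simp⟩⟩
      simpa [hdd] using hw.2
  · refine subquotientMap_exact (fun v hv => le_bdry _ hv.2) fun w hw hw' => ?_
    obtain ⟨u, hu, huw⟩ := mem_bdry_succ.mp hw'
    refine ⟨w - u, ⟨sub_mem hw.1 (hRS _ hu), by simpa using huw⟩, le_bdry _ ?_⟩
    simpa using hu
  · refine subquotientMap_exact (fun v hv => mem_bdry_succ.mpr ⟨v, hv.1, by simp⟩)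
      fun w hw hw' => ?_
    obtain ⟨u, hu, huw⟩ := mem_bdry_succ.mp hw'
    refine ⟨u, ⟨hu, ?_⟩, le_bdry _ ?_⟩
    · have := sub_mem hw.1 (hTR _ huw)
      simpa using this
    · have := neg_mem huw
      simpa using this

variable {V' : ℕ → Type*} [∀ q, AddCommGroup (V' q)] [∀ q, Module K (V' q)]
  {d' : ∀ q, V' q →ₗ[K] V' (q + 1)} {S' T' : ∀ q, Submodule K (V' q)}

/-- A cochain map `S / T → S' / T'` that is onto and has an acyclic kernel induces isomorphisms in
cohomology. -/
theorem nonempty_linearEquiv (f : ∀ q, V q →ₗ[K] V' q)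
    (hf : ∀ q v, f (q + 1) (d q v) = d' q (f q v)) (hdd : ∀ q v, d (q + 1) (d q v) = 0)
    (hS : ∀ q, ∀ v ∈ S q, d q v ∈ S (q + 1)) (hT' : ∀ q, ∀ v ∈ T' q, d' q v ∈ T' (q + 1))
    (hfS : ∀ q, ∀ v ∈ S q, f q v ∈ S' q) (hfT : ∀ q, ∀ v ∈ T q, f q v ∈ T' q)
    (surj : ∀ q, ∀ w ∈ S' q, ∃ v ∈ S q, f q v - w ∈ T' q)
    (acyc : ∀ q, ∀ v ∈ S q, f q v ∈ T' q → d q v ∈ T (q + 1) →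
      v ∈ bdry d (fun q => S q ⊓ (T' q).comap (f q)) T q) (q : ℕ) :
    Nonempty (H d S T q ≃ₗ[K] H d' S' T' q) := by
  have hB : ∀ v ∈ cyc d S T q, v ∈ bdry d S T q → f q v ∈ bdry d' S' T' q := by
    intro v _ hv
    cases q with
    | zero => exact hfT 0 v hv
    | succ q =>
      obtain ⟨u, hu, huv⟩ := mem_bdry_succ.mp hv
      refine mem_bdry_succ.mpr ⟨f q u, hfS q u hu, ?_⟩
      rw [← hf, ← map_sub]
      exact hfT _ _ huv
  have hZ : ∀ v ∈ cyc d S T q, f q v ∈ cyc d' S' T' q := fun v hv =>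
    ⟨hfS q v hv.1, by
      change d' q (f q v) ∈ T' (q + 1)
      rw [← hf]
      exact hfT _ _ hv.2⟩
  refine ⟨LinearEquiv.ofBijective (subquotientMap (f q) hZ hB) ⟨?_, ?_⟩⟩
  · refine subquotientMap_injective fun v hv hfv => ?_
    -- A cocycle in the kernel complex is a coboundary there, hence in S/T. A general cocycle with
    -- trivial image reduces to this case by lifting a primitive of its image and subtracting the
    -- coboundary of the lift.
    have key : ∀ v ∈ cyc d S T q, f q v ∈ T' q → v ∈ bdry d S T q := fun v hv h =>
      bdry_mono (fun q => inf_le_left) (fun _ => le_rfl) q (acyc q v hv.1 h hv.2)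
    cases q with
    | zero => exact key v hv hfv
    | succ q =>
      obtain ⟨u', hu', huv⟩ := mem_bdry_succ.mp hfv
      obtain ⟨u, hu, huu⟩ := surj q u' hu'
      have h₁ : v - d q u ∈ bdry d S T (q + 1) := by
        refine key _ ⟨sub_mem hv.1 (hS q u hu), ?_⟩ ?_
        · simpa [hdd] using hv.2
        · have := sub_mem huv (hT' q _ huu)
          rw [map_sub] at this
          rw [map_sub, hf]
          convert this using 1
          abel
      have h₂ : d q u ∈ bdry d S T (q + 1) := mem_bdry_succ.mpr ⟨u, hu, by simp⟩
      simpa using add_mem h₁ h₂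
  · refine subquotientMap_surjective fun w hw => ?_
    obtain ⟨v, hv, hvw⟩ := surj q w hw.1
    have h₁ : f (q + 1) (d q v) ∈ T' (q + 1) := by
      have := add_mem (hT' q _ hvw) hw.2
      rw [hf]
      simpa using this
    -- The lift `v` of the cocycle `w` need not be a cocycle, but `d q v` is a cocycle of the kernel
    -- complex. Acyclicity yields a primitive `u` in the kernel, and `v - u` is the corrected lift.
    obtain ⟨u, hu, huv⟩ := mem_bdry_succ.mp
      (acyc (q + 1) (d q v) (hS q v hv) h₁ (by simp [hdd]))
    refine ⟨v - u, ⟨sub_mem hv hu.1, by simpa using huv⟩, le_bdry q ?_⟩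
    have := sub_mem hvw hu.2
    rw [map_sub]
    convert this using 1
    abel

end

end PairCohomology

namespace AlexanderSpanier

/-! ### Operators on cochains -/

section

variable {K : Type*} [Field K] {X Y : Type*}

/-- Pull-back of cochains along a map. -/
def pull (K : Type*) [Field K] {X Y : Type*} (f : Y → X) (q : ℕ) :
    Cochain K X q →ₗ[K] Cochain K Y q where
  toFun φ t := φ (f ∘ t)
  map_add' _ _ := rfl
  map_smul' _ _ := rfl

theorem pull_apply (f : Y → X) {q : ℕ} (φ : Cochain K X q) (t : Fin (q + 1) → Y) :
    pull K f q φ t = φ (f ∘ t) := rfl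

theorem pull_delta (f : Y → X) (q : ℕ) (φ : Cochain K X q) :
    pull K f (q + 1) (delta K X q φ) = delta K Y q (pull K f q φ) := rfl

theorem delta_apply (q : ℕ) (φ : Cochain K X q) (t : Fin (q + 2) → X) :
    delta K X q φ t = ∑ i : Fin (q + 2), (-1 : K) ^ (i : ℕ) * φ (t ∘ i.succAbove) := rfl

/-- Insertion of a fixed first vertex. -/
def cone (x : X) {q : ℕ} (φ : Cochain K X (q + 1)) : Cochain K X q := fun t => φ (Fin.cons x t)

/-- Omitting the first vertex gives φ(t); every other face keeps it, with its index, and so its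
sign, shifted by one. Thus inserting a vertex is a contracting homotopy, which drives the inductions
below. -/
theorem delta_cons (q : ℕ) (φ : Cochain K X (q + 1)) (x : X) (t : Fin (q + 2) → X) :
    delta K X (q + 1) φ (Fin.cons x t) = φ t - delta K X q (cone x φ) t := by
  rw [delta_apply, Fin.sum_univ_succ, delta_apply]
  have h₀ : (Fin.cons x t : Fin (q + 3) → X) ∘ (0 : Fin (q + 3)).succAbove = t := by
    funext i
    simp
  rw [h₀, sub_eq_add_neg, ← Finset.sum_neg_distrib]
  congr 1
  · simp
  · refine Finset.sum_congr rfl fun i _ => ?_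
    have h : (Fin.cons x t : Fin (q + 3) → X) ∘ i.succ.succAbove =
        Fin.cons x (t ∘ i.succAbove) := by
      funext j
      refine Fin.cases ?_ (fun j => ?_) j <;> simp
    rw [h, Fin.val_succ, pow_succ, cone]
    ring

theorem cone_delta (q : ℕ) (φ : Cochain K X (q + 1)) (x : X) :
    cone x (delta K X (q + 1) φ) = φ - delta K X q (cone x φ) :=
  funext fun t => delta_cons q φ x t

theorem delta_zero_apply (φ : Cochain K X 0) (t : Fin 2 → X) :
    delta K X 0 φ t = φ (fun _ => t 1) - φ fun _ => t 0 := by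
  have h₀ : t ∘ (0 : Fin 2).succAbove = fun _ => t 1 := by
    funext i
    rw [show i = 0 from Fin.fin_one_eq_zero i]
    rfl
  have h₁ : t ∘ (1 : Fin 2).succAbove = fun _ => t 0 := by
    funext i
    rw [show i = 0 from Fin.fin_one_eq_zero i]
    rfl
  rw [delta_apply, Fin.sum_univ_two, h₀, h₁]
  simp [sub_eq_add_neg]

theorem delta_zero_cons (φ : Cochain K X 0) (x : X) (t : Fin 1 → X) :
    delta K X 0 φ (Fin.cons x t) = φ t - φ fun _ => x := by
  rw [delta_zero_apply]
  congr 2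
  funext i
  rw [show i = 0 from Fin.fin_one_eq_zero i]
  rfl

theorem delta_delta (q : ℕ) (φ : Cochain K X q) : delta K X (q + 1) (delta K X q φ) = 0 := by
  induction q with
  | zero =>
    funext t
    rw [← Fin.cons_self_tail t, delta_cons, delta_zero_apply, delta_zero_apply]
    have h : ∀ y, cone (t 0) (delta K X 0 φ) (fun _ => y) = φ (fun _ => y) - φ fun _ => t 0 :=
      fun y => delta_zero_cons φ (t 0) fun _ => y
    rw [h, h, Pi.zero_apply]
    ring
  | succ q ih =>
    funext t
    -- With c the insertion of the first vertex, δδφ evaluates to δφ - δ(cδφ) = δφ - δ(φ - δcφ) =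
    -- δδ(cφ), which is zero in one degree less.
    rw [← Fin.cons_self_tail t, delta_cons, cone_delta, map_sub, ih (cone (t 0) φ)]
    simp

/-- The prism operator between two maps `f, g`: the alternating sum of the values
`φ (f x₀, …, f xᵢ, g xᵢ, …, g x_q)`. -/
def prism (f g : Y → X) : (q : ℕ) → Cochain K X (q + 1) → Cochain K Y q
  | 0, φ => fun t => φ (Fin.cons (f (t 0)) (g ∘ t))
  | q + 1, φ => fun t => φ (Fin.cons (f (t 0)) (g ∘ t)) -
      prism f g q (cone (f (t 0)) φ) (Fin.tail t)

theorem prism_sub (f g : Y → X) (q : ℕ) (φ ψ : Cochain K X (q + 1)) :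
    prism f g q (φ - ψ) = prism f g q φ - prism f g q ψ := by
  induction q with
  | zero => rfl
  | succ q ih =>
    funext t
    have h : cone (f (t 0)) (φ - ψ) = cone (f (t 0)) φ - cone (f (t 0)) ψ := rfl
    simp only [prism, h, ih, Pi.sub_apply]
    ring

theorem prism_delta_zero (f g : Y → X) (φ : Cochain K X 0) :
    prism f g 0 (delta K X 0 φ) = pull K g 0 φ - pull K f 0 φ := by
  funext t
  change delta K X 0 φ (Fin.cons (f (t 0)) (g ∘ t)) = _
  rw [delta_zero_cons, Pi.sub_apply, pull_apply, pull_apply]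
  congr 2
  funext i
  rw [show i = 0 from Fin.fin_one_eq_zero i]
  rfl

theorem comp_cons (f : Y → X) {q : ℕ} (x : Y) (t : Fin q → Y) :
    f ∘ (Fin.cons x t : Fin (q + 1) → Y) = Fin.cons (f x) (f ∘ t) := by
  funext i
  refine Fin.cases ?_ (fun i => ?_) i <;> simp

theorem prism_succ_cons (f g : Y → X) (q : ℕ) (φ : Cochain K X (q + 2)) (x : Y)
    (t : Fin (q + 1) → Y) :
    prism f g (q + 1) φ (Fin.cons x t) =
      cone (g x) (cone (f x) φ) (g ∘ t) - prism f g q (cone (f x) φ) t := by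
  simp only [prism, cone, Fin.cons_zero, Fin.tail_cons, comp_cons]

/-- The cochain homotopy between the pull-backs by `f` and `g`, proved by peeling off the first
vertex. No continuity enters: it is an identity between arbitrary functions. -/
theorem delta_prism (f g : Y → X) (q : ℕ) (φ : Cochain K X (q + 1)) :
    delta K Y q (prism f g q φ) + prism f g (q + 1) (delta K X (q + 1) φ) =
      pull K g (q + 1) φ - pull K f (q + 1) φ := by
  induction q with
  | zero =>
    funext t
    obtain ⟨x, t, rfl⟩ : ∃ x u, t = Fin.cons x u := ⟨t 0, Fin.tail t, (Fin.cons_self_tail t).symm⟩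
    have h₁ : prism f g 0 φ (fun _ => x) = cone (f x) φ fun _ => g x := rfl
    simp only [Pi.add_apply, Pi.sub_apply, prism_succ_cons, delta_zero_cons, cone_delta,
      prism_sub, prism_delta_zero, pull_apply, comp_cons, h₁]
    have h₂ : ∀ u, cone (g x) (φ - delta K X 0 (cone (f x) φ)) u =
      φ (Fin.cons (g x) u) - delta K X 0 (cone (f x) φ) (Fin.cons (g x) u) := fun _ => rfl
    rw [h₂, delta_zero_cons]
    simp only [cone]
    ring
  | succ q ih =>
    funext t
    obtain ⟨x, t, rfl⟩ : ∃ x u, t = Fin.cons x u := ⟨t 0, Fin.tail t, (Fin.cons_self_tail t).symm⟩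
    have h₁ : cone x (prism f g (q + 1) φ) =
        pull K g q (cone (g x) (cone (f x) φ)) - prism f g q (cone (f x) φ) :=
      funext fun u => prism_succ_cons f g q φ x u
    have h₂ : ∀ u, cone (g x) (φ - delta K X (q + 1) (cone (f x) φ)) u =
      φ (Fin.cons (g x) u) - delta K X (q + 1) (cone (f x) φ) (Fin.cons (g x) u) := fun _ => rfl
    have h₃ := congrFun (ih (cone (f x) φ)) t
    simp only [Pi.add_apply, Pi.sub_apply, pull_apply] at h₃
    simp only [Pi.add_apply, Pi.sub_apply, prism_succ_cons (q := q + 1), delta_cons, cone_delta,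
      prism_sub, pull_apply, comp_cons, h₁, h₂, map_sub, ← pull_delta]
    simp only [cone] at h₃ ⊢
    linear_combination h₃

/-- A prism value vanishes as soon as the cochain vanishes on all tuples with entries among the
`f (t j)` and `g (t j)`. -/
theorem prism_eq_zero (f g : Y → X) (q : ℕ) (φ : Cochain K X (q + 1)) (t : Fin (q + 1) → Y)
    (h : ∀ u : Fin (q + 2) → X, (∀ i, ∃ j, u i = f (t j) ∨ u i = g (t j)) → φ u = 0) :
    prism f g q φ t = 0 := by
  have h₀ : φ (Fin.cons (f (t 0)) (g ∘ t)) = 0 := by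
    refine h _ fun i => ?_
    refine Fin.cases ⟨0, Or.inl ?_⟩ (fun i => ⟨i, Or.inr ?_⟩) i <;> simp
  induction q with
  | zero => exact h₀
  | succ q ih =>
    have key : ∀ u : Fin (q + 2) → X,
        (∀ i, ∃ j, u i = f (Fin.tail t j) ∨ u i = g (Fin.tail t j)) →
        cone (f (t 0)) φ u = 0 := by
      refine fun u hu => h _ fun i => Fin.cases ⟨0, Or.inl (by simp)⟩ (fun i => ?_) i
      obtain ⟨j, hj⟩ := hu i
      exact ⟨j.succ, by simpa [Fin.tail] using hj⟩
    change φ (Fin.cons (f (t 0)) (g ∘ t)) - prism f g q (cone (f (t 0)) φ) (Fin.tail t) = 0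
    rw [h₀, ih _ _ key, sub_zero]
    refine key _ fun i => ?_
    refine Fin.cases ⟨0, Or.inl ?_⟩ (fun i => ⟨i, Or.inr ?_⟩) i <;> simp

end

/-! ### Truncation of cochains -/

section

variable {K : Type*} [Field K] {X : Type*} {q : ℕ}

open Classical in
/-- Truncation of a cochain to the tuples with entries in `W`. -/
noncomputable def cut (W : Set X) (φ : Cochain K X q) : Cochain K X q :=
  fun t => if ∀ i, t i ∈ W then φ t else 0

theorem cut_of_mem {W : Set X} {φ : Cochain K X q} {t : Fin (q + 1) → X} (h : ∀ i, t i ∈ W) :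
    cut W φ t = φ t := if_pos h

theorem cut_of_notMem {W : Set X} {φ : Cochain K X q} {t : Fin (q + 1) → X} (i : Fin (q + 1))
    (h : t i ∉ W) : cut W φ t = 0 := if_neg fun hc => h (hc i)

end

/-! ### Local behaviour of cochains -/

section

variable {K : Type*} [Field K] {X Y : Type*} [TopologicalSpace X] [TopologicalSpace Y] {q : ℕ}

theorem VanishesNear.add {φ ψ : Cochain K X q} {x : X} (h : VanishesNear φ x)
    (h' : VanishesNear ψ x) : VanishesNear (φ + ψ) x := by
  obtain ⟨U, hU, hU'⟩ := h
  obtain ⟨W, hW, hW'⟩ := h'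
  exact ⟨U ∩ W, Filter.inter_mem hU hW, fun t ht => by
    simp [hU' t fun i => (ht i).1, hW' t fun i => (ht i).2]⟩

theorem VanishesNear.smul {φ : Cochain K X q} {x : X} (a : K) (h : VanishesNear φ x) :
    VanishesNear (a • φ) x := by
  obtain ⟨U, hU, hU'⟩ := h
  exact ⟨U, hU, fun t ht => by simp [hU' t ht]⟩

theorem VanishesNear.neg {φ : Cochain K X q} {x : X} (h : VanishesNear φ x) :
    VanishesNear (-φ) x := by
  simpa using h.smul (-1)

theorem VanishesNear.sub {φ ψ : Cochain K X q} {x : X} (h : VanishesNear φ x)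
    (h' : VanishesNear ψ x) : VanishesNear (φ - ψ) x := by
  simpa [sub_eq_add_neg] using h.add h'.neg

theorem vanishesNear_zero (x : X) : VanishesNear (0 : Cochain K X q) x :=
  ⟨Set.univ, Filter.univ_mem, fun _ _ => rfl⟩

theorem VanishesNear.delta {φ : Cochain K X q} {x : X} (h : VanishesNear φ x) :
    VanishesNear (delta K X q φ) x := by
  obtain ⟨U, hU, hU'⟩ := h
  exact ⟨U, hU, fun t ht => by
    rw [delta_apply]
    exact Finset.sum_eq_zero fun i _ => by rw [hU' (t ∘ i.succAbove) fun j => ht _, mul_zero]⟩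

theorem VanishesNear.pull {φ : Cochain K X q} {f : Y → X} {y : Y} (hf : ContinuousAt f y)
    (h : VanishesNear φ (f y)) : VanishesNear (pull K f q φ) y := by
  obtain ⟨U, hU, hU'⟩ := h
  exact ⟨f ⁻¹' U, hf hU, fun t ht => hU' _ ht⟩

theorem VanishesNear.prism {φ : Cochain K X (q + 1)} {f g : Y → X} {x : X} {y : Y}
    (hf : Filter.Tendsto f (𝓝 y) (𝓝 x)) (hg : Filter.Tendsto g (𝓝 y) (𝓝 x))
    (h : VanishesNear φ x) : VanishesNear (prism f g q φ) y := by
  obtain ⟨U, hU, hU'⟩ := h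
  refine ⟨f ⁻¹' U ∩ g ⁻¹' U, Filter.inter_mem (hf hU) (hg hU), fun t ht => ?_⟩
  refine prism_eq_zero f g q φ t fun u hu => hU' u fun i => ?_
  obtain ⟨j, hj | hj⟩ := hu i
  · exact hj ▸ (ht j).1
  · exact hj ▸ (ht j).2

theorem mem_zeroCochains {φ : Cochain K X q} :
    φ ∈ zeroCochains K X q ↔ ∀ x, VanishesNear φ x := by
  change supp φ = ∅ ↔ _
  simp [Set.eq_empty_iff_forall_notMem, supp]

theorem mem_compactCochains_of_vanishesNear {φ : Cochain K X q} {C : Set X} (hC : IsCompact C)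
    (h : ∀ x ∉ C, VanishesNear φ x) : φ ∈ compactCochains K X q :=
  hC.of_isClosed_subset (isClosed_supp φ) fun x hx => by
    by_contra hc
    exact hx (h x hc)

theorem vanishesNear_of_notMem_supp {φ : Cochain K X q} {x : X} (h : x ∉ supp φ) :
    VanishesNear φ x := not_not.mp h

theorem zeroCochains_le : zeroCochains K X q ≤ compactCochains K X q := fun _ hφ =>
  mem_compactCochains_of_vanishesNear isCompact_empty fun x _ => mem_zeroCochains.mp hφ x

theorem delta_mem_zeroCochains {φ : Cochain K X q} (h : φ ∈ zeroCochains K X q) :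
    delta K X q φ ∈ zeroCochains K X (q + 1) :=
  mem_zeroCochains.mpr fun x => (mem_zeroCochains.mp h x).delta

theorem delta_mem_compactCochains {φ : Cochain K X q} (h : φ ∈ compactCochains K X q) :
    delta K X q φ ∈ compactCochains K X (q + 1) :=
  mem_compactCochains_of_vanishesNear h fun _ hx => (vanishesNear_of_notMem_supp hx).delta

theorem VanishesNear.cut {W : Set X} {φ : Cochain K X q} {x : X} (h : VanishesNear φ x) :
    VanishesNear (cut W φ) x := by
  obtain ⟨U, hU, hU'⟩ := h
  refine ⟨U, hU, fun t ht => ?_⟩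
  rw [AlexanderSpanier.cut, hU' t ht, ite_self]

theorem vanishesNear_cut_sub {W : Set X} {φ : Cochain K X q} {x : X}
    (h : W ∈ 𝓝 x ∨ VanishesNear φ x) : VanishesNear (cut W φ - φ) x := by
  rcases h with h | h
  · exact ⟨W, h, fun t ht => by simp [cut_of_mem ht]⟩
  · exact h.cut.sub h

theorem vanishesNear_cut_of_notMem_closure {W : Set X} {φ : Cochain K X q} {x : X}
    (h : x ∉ closure W) : VanishesNear (cut W φ) x :=
  ⟨(closure W)ᶜ, isClosed_closure.isOpen_compl.mem_nhds h, fun _ ht =>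
    cut_of_notMem 0 fun hc => ht 0 (subset_closure hc)⟩

end

end AlexanderSpanier

namespace AlexanderSpanier

/-! ### Additivity of the Euler characteristic with compact supports -/

section

variable {K : Type*} [Field K] {X Y : Type*} {q : ℕ}

open Classical in
/-- Extension by zero of a cochain along a map. -/
noncomputable def ext (f : Y → X) (φ : Cochain K Y q) : Cochain K X q :=
  fun t => if h : ∀ i, t i ∈ Set.range f then φ (fun i => (h i).choose) else 0

theorem ext_of_notMem {f : Y → X} {φ : Cochain K Y q} {t : Fin (q + 1) → X} (i : Fin (q + 1))
    (h : t i ∉ Set.range f) : ext f φ t = 0 := dif_neg fun hc => h (hc i)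

theorem ext_comp {f : Y → X} (hf : Function.Injective f) (φ : Cochain K Y q)
    (t : Fin (q + 1) → Y) : ext f φ (f ∘ t) = φ t := by
  have h : ∀ i, (f ∘ t) i ∈ Set.range f := fun i => ⟨t i, rfl⟩
  rw [ext, dif_pos h]
  congr 1
  funext i
  exact hf (h i).choose_spec

theorem pull_ext {f : Y → X} (hf : Function.Injective f) (φ : Cochain K Y q) :
    pull K f q (ext f φ) = φ := funext fun t => ext_comp hf φ t

theorem pull_cut (f : Y → X) (W : Set X) (φ : Cochain K X q) :
    pull K f q (cut W φ) = cut (f ⁻¹' W) (pull K f q φ) := rfl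

end

/-! ### Comparison with an open and with a closed subspace -/

section

variable (K : Type*) [Field K] {X : Type*} [TopologicalSpace X]

/-- Cohomology with compact supports as the cohomology of a pair of subcomplexes. -/
abbrev CompactCohomology (X : Type*) [TopologicalSpace X] (q : ℕ) : Type _ :=
  PairCohomology.H (delta K X) (compactCochains K X) (zeroCochains K X) q

theorem coboundaries_eq_bdry (X : Type*) [TopologicalSpace X] (q : ℕ) :
    coboundaries K X q =
      PairCohomology.bdry (delta K X) (compactCochains K X) (zeroCochains K X) q := by
  cases q <;> rfl

/-- The identification of `Hc` with the cohomology of the pair. -/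
def compactCohomologyEquiv (X : Type*) [TopologicalSpace X] (q : ℕ) :
    CompactCohomology K X q ≃ₗ[K] Hc K X q :=
  Submodule.quotEquivOfEq _ _ (by rw [coboundaries_eq_bdry]; rfl)

/-- Compactly supported cochains whose support does not meet `Z`. -/
def awayCochains (Z : Set X) (q : ℕ) : Submodule K (Cochain K X q) where
  carrier := {φ | φ ∈ compactCochains K X q ∧ ∀ x ∈ Z, VanishesNear φ x}
  zero_mem' := ⟨zero_mem _, fun x _ => vanishesNear_zero x⟩
  add_mem' h h' := ⟨add_mem h.1 h'.1, fun x hx => (h.2 x hx).add (h'.2 x hx)⟩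
  smul_mem' a _ h := ⟨Submodule.smul_mem _ a h.1, fun x hx => (h.2 x hx).smul a⟩

variable {K} {U Z : Type*} [TopologicalSpace U] [TopologicalSpace Z] {q : ℕ}

theorem vanishesNear_of_pull {j : U → X} (hj : IsOpenEmbedding j) {φ : Cochain K X q} {u : U}
    (h : VanishesNear (pull K j q φ) u) : VanishesNear φ (j u) := by
  obtain ⟨W, hW, hW'⟩ := h
  refine ⟨j '' W, hj.image_mem_nhds.mpr hW, fun t ht => ?_⟩
  choose t' ht' htt' using ht
  obtain rfl : j ∘ t' = t := funext htt'
  exact hW' t' ht'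

/-- A cochain supported inside the open set is determined by its restriction up to cochains of empty
support, so the kernel complex is zero. Only the lifting of compactly supported cochains needs work.
-/
theorem nonempty_equiv_of_isOpenEmbedding [LocallyCompactSpace X] [T2Space X] {j : U → X}
    (hj : IsOpenEmbedding j) (q : ℕ) :
    Nonempty (PairCohomology.H (delta K X) (awayCochains K (Set.range j)ᶜ) (zeroCochains K X) q ≃ₗ[K]
      CompactCohomology K U q) := by
  refine PairCohomology.nonempty_linearEquiv (d' := delta K U)
    (S := awayCochains K (Set.range j)ᶜ) (S' := compactCochains K U)
    (T' := zeroCochains K U) (fun q => pull K j q) (fun q φ => pull_delta j q φ)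
    (fun q φ => delta_delta q φ)
    (fun q φ h => ⟨delta_mem_compactCochains h.1, fun x hx => (h.2 x hx).delta⟩)
    (fun q φ h => delta_mem_zeroCochains h) (fun q φ h => ?_) (fun q φ h => ?_) (fun q w hw => ?_)
    (fun q φ h h' _ => PairCohomology.le_bdry q ?_) q
  · have hs : supp φ ⊆ Set.range j := fun x hx => by
      by_contra hc
      exact hx (h.2 x hc)
    exact mem_compactCochains_of_vanishesNear (hj.isInducing.isCompact_preimage' h.1 hs)
      fun u hu => (vanishesNear_of_notMem_supp hu).pull hj.continuous.continuousAt
  · exact mem_zeroCochains.mpr fun u => (mem_zeroCochains.mp h _).pull hj.continuous.continuousAt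
  -- Extension by zero alone need not vanish near the frontier of the open set, since the
  -- neighbourhoods on which `w` vanishes may shrink there. Truncating to a compact neighbourhood of
  -- the support cures this and changes `w` only by a cochain of empty support.
  · obtain ⟨L, hL, hwL, hLj⟩ := exists_compact_between (IsCompact.image hw hj.continuous)
      hj.isOpen_range (Set.image_subset_range _ _)
    have hcl : closure (interior L) ⊆ L := closure_minimal interior_subset hL.isClosed
    refine ⟨cut (interior L) (ext j w), ⟨?_, fun x hx => ?_⟩, ?_⟩
    · exact mem_compactCochains_of_vanishesNear hL fun x hx =>
        vanishesNear_cut_of_notMem_closure fun hc => hx (hcl hc)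
    · exact vanishesNear_cut_of_notMem_closure fun hc => hx (hLj (hcl hc))
    · rw [pull_cut, pull_ext hj.injective]
      refine mem_zeroCochains.mpr fun u => vanishesNear_cut_sub ?_
      by_cases hu : u ∈ supp w
      · exact Or.inl (hj.continuous.continuousAt (isOpen_interior.mem_nhds (hwL ⟨u, hu, rfl⟩)))
      · exact Or.inr (vanishesNear_of_notMem_supp hu)
  · refine mem_zeroCochains.mpr fun x => ?_
    by_cases hx : x ∈ Set.range j
    · obtain ⟨u, rfl⟩ := hx
      exact vanishesNear_of_pull hj (mem_zeroCochains.mp h' u)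
    · exact h.2 x hx

theorem vanishesNear_ext {i : Z → X} (hi : IsClosedEmbedding i) {φ : Cochain K Z q} {x : X}
    (hx : x ∉ i '' supp φ) : VanishesNear (ext i φ) x := by
  by_cases hx' : x ∈ Set.range i
  · obtain ⟨z, rfl⟩ := hx'
    obtain ⟨W, hW, hW'⟩ := vanishesNear_of_notMem_supp fun hc => hx ⟨z, hc, rfl⟩
    rw [hi.isInducing.nhds_eq_comap, Filter.mem_comap] at hW
    obtain ⟨O, hO, hOW⟩ := hW
    refine ⟨O, hO, fun t ht => ?_⟩
    by_cases h : ∀ k, t k ∈ Set.range i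
    · choose t' ht' using h
      obtain rfl : i ∘ t' = t := funext ht'
      rw [ext_comp hi.injective]
      exact hW' t' fun k => hOW (ht k)
    · obtain ⟨k, hk⟩ := not_forall.mp h
      exact ext_of_notMem k hk
  · exact ⟨(Set.range i)ᶜ, hi.isClosed_range.isOpen_compl.mem_nhds hx', fun t ht =>
      ext_of_notMem 0 (ht 0)⟩

/-- A cochain whose restriction to a subspace vanishes near `z` vanishes near `z` after pull-back
along any map into the subspace that is continuous at `z`. -/
theorem vanishesNear_pull_of_tendsto {i : Z → X} (hi : IsInducing i) {r : X → X} {z : Z}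
    (hr : Filter.Tendsto r (𝓝 (i z)) (𝓝[Set.range i] (i z))) {φ : Cochain K X q}
    (h : VanishesNear (pull K i q φ) z) : VanishesNear (pull K r q φ) (i z) := by
  obtain ⟨W, hW, hW'⟩ := h
  rw [hi.nhds_eq_comap, Filter.mem_comap] at hW
  obtain ⟨O, hO, hOW⟩ := hW
  refine ⟨r ⁻¹' (Set.range i ∩ O), hr (inter_mem_nhdsWithin _ hO), fun t ht => ?_⟩
  choose t' ht' using fun k => (ht k).1
  have h : i ∘ t' = r ∘ t := funext ht'
  rw [pull_apply, ← h]
  refine hW' t' fun k => hOW ?_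
  change i (t' k) ∈ O
  rw [ht' k]
  exact (ht k).2

/-- Extension by zero gives surjectivity. For the kernel, let P be the prism operator from `id` to
`r`, so that φ = r*φ - δPφ - Pδφ. If φ restricts to zero on Z and δφ vanishes near Z, then r*φ and
Pδφ vanish near Z, and φ is cohomologous to a cochain supported away from Z. The limits of `r` at
points of Z suffice. -/
theorem nonempty_equiv_of_retraction [LocallyCompactSpace X] [T2Space X] {i : Z → X}
    (hi : IsClosedEmbedding i) {r : X → X} (hri : ∀ z, r (i z) = i z)
    (hr : ∀ z, Filter.Tendsto r (𝓝 (i z)) (𝓝[Set.range i] (i z))) (q : ℕ) :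
    Nonempty (PairCohomology.H (delta K X) (compactCochains K X) (awayCochains K (Set.range i)) q
      ≃ₗ[K] CompactCohomology K Z q) := by
  have hr' : ∀ z, Filter.Tendsto r (𝓝 (i z)) (𝓝 (i z)) := fun z =>
    (hr z).mono_right nhdsWithin_le_nhds
  refine PairCohomology.nonempty_linearEquiv (d' := delta K Z) (S' := compactCochains K Z)
    (T' := zeroCochains K Z) (fun q => pull K i q) (fun q φ => pull_delta i q φ)
    (fun q φ => delta_delta q φ) (fun q φ h => delta_mem_compactCochains h)
    (fun q φ h => delta_mem_zeroCochains h) (fun q φ h => ?_) (fun q φ h => ?_) (fun q w hw => ?_)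
    (fun q φ h h' hδ => ?_) q
  · exact mem_compactCochains_of_vanishesNear (hi.isCompact_preimage h)
      fun u hu => (vanishesNear_of_notMem_supp hu).pull hi.continuous.continuousAt
  · exact mem_zeroCochains.mpr fun z => (h.2 _ ⟨z, rfl⟩).pull hi.continuous.continuousAt
  · refine ⟨ext i w, mem_compactCochains_of_vanishesNear (IsCompact.image hw hi.continuous)
      fun x hx => vanishesNear_ext hi hx, ?_⟩
    rw [pull_ext hi.injective, sub_self]
    exact zero_mem _
  · have hv : ∀ z, VanishesNear (pull K r q φ) (i z) := fun z =>
      vanishesNear_pull_of_tendsto hi.isInducing (hr z) (mem_zeroCochains.mp h' z)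
    have hp : ∀ z, VanishesNear (prism id r q (delta K X q φ)) (i z) := fun z =>
      (hδ.2 _ ⟨z, rfl⟩).prism Filter.tendsto_id (hr' z)
    cases q with
    | zero =>
      refine ⟨h, ?_⟩
      rintro _ ⟨z, rfl⟩
      have := (hv z).sub (hp z)
      have h₀ : pull K id 0 φ = φ := rfl
      rwa [prism_delta_zero, sub_sub_cancel, h₀] at this
    | succ q =>
      -- `r` is uncontrolled off Z, so Pφ need not have compact support; it is truncated to a
      -- compact neighbourhood of the support of φ.
      obtain ⟨L, hL, hφL, -⟩ := exists_compact_between (IsCompact.image h continuous_id)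
        isOpen_univ (Set.subset_univ _)
      rw [Set.image_id] at hφL
      have hcl : closure (interior L) ⊆ L := closure_minimal interior_subset hL.isClosed
      set p := prism id r q φ
      have hw : cut (interior L) p ∈ compactCochains K X q :=
        mem_compactCochains_of_vanishesNear hL fun x hx =>
          vanishesNear_cut_of_notMem_closure fun hc => hx (hcl hc)
      refine PairCohomology.mem_bdry_succ.mpr ⟨-cut (interior L) p, ⟨neg_mem hw, ?_⟩,
        sub_mem h (delta_mem_compactCochains (neg_mem hw)), ?_⟩
      · change pull K i q (-cut (interior L) p) ∈ zeroCochains K Z q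
        rw [map_neg, pull_cut]
        refine neg_mem (mem_zeroCochains.mpr fun z => VanishesNear.cut ?_)
        obtain ⟨W, hW, hW'⟩ := mem_zeroCochains.mp h' z
        -- On Z both `id` and `r` fix points, so Pφ evaluates φ only on tuples of Z, where it
        -- vanishes locally.
        refine ⟨W, hW, fun t ht => prism_eq_zero _ _ _ _ _ fun u hu => ?_⟩
        have : ∀ k, ∃ j, i (t j) = u k := fun k => by
          obtain ⟨j, hj⟩ := hu k
          exact ⟨j, by simpa [hri, eq_comm] using hj⟩
        choose s hs using this
        obtain rfl : i ∘ (t ∘ s) = u := funext hs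
        exact hW' _ fun k => ht _
      · rintro _ ⟨z, rfl⟩
        -- Truncation is harmless near Z: at points of the support of φ it changes nothing, and
        -- elsewhere on Z the prism already vanishes locally.
        have h₁ : VanishesNear (cut (interior L) p - p) (i z) := by
          refine vanishesNear_cut_sub ?_
          by_cases hz : i z ∈ supp φ
          · exact Or.inl (isOpen_interior.mem_nhds (hφL hz))
          · exact Or.inr ((vanishesNear_of_notMem_supp hz).prism Filter.tendsto_id (hr' z))
        have h₂ := ((hv z).sub (hp z)).add h₁.delta
        convert h₂ using 1
        have h₃ := delta_prism id r q φ
        have h₄ : pull K id (q + 1) φ = φ := rfl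
        rw [h₄] at h₃
        rw [map_neg, map_sub, eq_sub_of_add_eq' h₃]
        abel

end

/-! ### Additivity over closed subsets of metric spaces -/

section

variable {K : Type*} [Field K]

/-- Each point is sent to an almost nearest point of Z. The factor 2 leaves room when the distance
is not attained, and it forces points of Z to be fixed because their distance to Z is 0. The
triangle inequality then gives the bound 3 = 2 + 1 that yields continuity at Z. -/
theorem exists_retraction {X : Type*} [MetricSpace X] {Z : Set X} (hZ : IsClosed Z) :
    ∃ r : X → X, (∀ z ∈ Z, r z = z) ∧ ∀ z ∈ Z, Filter.Tendsto r (𝓝 z) (𝓝[Z] z) := by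
  rcases Z.eq_empty_or_nonempty with rfl | hne
  · exact ⟨id, by simp, by simp⟩
  have h : ∀ x, ∃ y ∈ Z, dist x y ≤ 2 * Metric.infDist x Z := fun x => by
    by_cases hx : x ∈ Z
    · exact ⟨x, hx, by simpa using Metric.infDist_nonneg⟩
    · have hpos := (hZ.notMem_iff_infDist_pos hne).mp hx
      obtain ⟨y, hy, hxy⟩ := (Metric.infDist_lt_iff hne).mp
        (show Metric.infDist x Z < 2 * Metric.infDist x Z by linarith)
      exact ⟨y, hy, hxy.le⟩
  choose r hrZ hr using h
  have hle : ∀ z ∈ Z, ∀ x, dist (r x) z ≤ 3 * dist x z := fun z hz x => by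
    have h₁ := hr x
    have h₂ := Metric.infDist_le_dist_of_mem (x := x) hz
    have h₃ := dist_triangle_left (r x) z x
    linarith
  refine ⟨r, fun z hz => ?_, fun z hz => tendsto_nhdsWithin_iff.mpr ⟨?_, .of_forall hrZ⟩⟩
  · have := hle z hz z
    rw [dist_self, mul_zero] at this
    exact dist_le_zero.mp this
  · rw [tendsto_iff_dist_tendsto_zero]
    refine squeeze_zero (fun _ => dist_nonneg) (hle z hz) ?_
    have : Filter.Tendsto (fun x => 3 * dist x z) (𝓝 z) (𝓝 (3 * dist z z)) :=
      Continuous.tendsto (by fun_prop) z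
    simpa using this

/-- The cohomology with compact supports of `X` over `K` has finite total dimension and Euler
characteristic `n`. -/
abbrev HasChi (K : Type*) [Field K] (X : Type*) [TopologicalSpace X] (n : ℤ) : Prop :=
  PairCohomology.HasEuler K (CompactCohomology K X) n

theorem exists_longExact_away (K : Type*) [Field K] {X : Type*} [TopologicalSpace X] (Z : Set X) :
    ∃ (a : ∀ q, PairCohomology.H (delta K X) (awayCochains K Z) (zeroCochains K X) q
        →ₗ[K] CompactCohomology K X q)
      (b : ∀ q, CompactCohomology K X q →ₗ[K]
        PairCohomology.H (delta K X) (compactCochains K X) (awayCochains K Z) q)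
      (c : ∀ q, PairCohomology.H (delta K X) (compactCochains K X) (awayCochains K Z) q →ₗ[K]
        PairCohomology.H (delta K X) (awayCochains K Z) (zeroCochains K X) (q + 1)),
      PairCohomology.LongExact a b c :=
  PairCohomology.exists_longExact (S := compactCochains K X) (fun q φ => delta_delta q φ)
    (fun _ _ h => ⟨zeroCochains_le h, fun x _ => mem_zeroCochains.mp h x⟩) fun _ _ h => h.1

theorem nonempty_equiv_open (K : Type*) [Field K] {X U : Type*} [TopologicalSpace X] [T2Space X]
    [LocallyCompactSpace X] [TopologicalSpace U] {Z : Set X} {j : U → X}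
    (hj : IsOpenEmbedding j) (hZ : Set.range j = Zᶜ) (q : ℕ) :
    Nonempty (PairCohomology.H (delta K X) (awayCochains K Z) (zeroCochains K X) q ≃ₗ[K]
      CompactCohomology K U q) := by
  have := nonempty_equiv_of_isOpenEmbedding (K := K) hj q
  rwa [hZ, compl_compl] at this

variable {X U Z : Type*} [MetricSpace X] [LocallyCompactSpace X] [TopologicalSpace U]
  [TopologicalSpace Z] {i : Z → X} {j : U → X} {m n : ℤ}

theorem nonempty_equiv_closed (K : Type*) [Field K] (hi : IsClosedEmbedding i) (q : ℕ) :
    Nonempty (PairCohomology.H (delta K X) (compactCochains K X) (awayCochains K (Set.range i)) q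
      ≃ₗ[K] CompactCohomology K Z q) := by
  obtain ⟨r, hr₁, hr₂⟩ := exists_retraction hi.isClosed_range
  exact nonempty_equiv_of_retraction hi (fun z => hr₁ _ ⟨z, rfl⟩) (fun z => hr₂ _ ⟨z, rfl⟩) q

theorem HasChi.closed (hi : IsClosedEmbedding i) (hj : IsOpenEmbedding j)
    (hij : Set.range j = (Set.range i)ᶜ) (hX : HasChi K X m) (hU : HasChi K U n) :
    HasChi K Z (m - n) := by
  obtain ⟨a, b, c, h⟩ := exists_longExact_away K (Set.range i)
  exact (h.hasEuler_right (hU.of_equiv fun q => (nonempty_equiv_open K hj hij q).some.symm)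
    hX).of_equiv fun q => (nonempty_equiv_closed K hi q).some

theorem HasChi.open (hi : IsClosedEmbedding i) (hj : IsOpenEmbedding j)
    (hij : Set.range j = (Set.range i)ᶜ) (hX : HasChi K X m) (hZ : HasChi K Z n) :
    HasChi K U (m - n) := by
  obtain ⟨a, b, c, h⟩ := exists_longExact_away K (Set.range i)
  exact (h.hasEuler_left hX (hZ.of_equiv fun q =>
    (nonempty_equiv_closed K hi q).some.symm)).of_equiv
      fun q => (nonempty_equiv_open K hj hij q).some

theorem HasChi.of_isEmpty {X : Type*} [TopologicalSpace X] [IsEmpty X] : HasChi K X 0 := by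
  refine PairCohomology.HasEuler.of_subsingleton fun q => ?_
  refine PairCohomology.subsingleton_H_iff.mpr fun φ _ => ?_
  have : φ = 0 := funext fun t => isEmptyElim (t 0)
  rw [this]
  exact zero_mem _

/-- Additivity for a closed subspace whose complement is empty. -/
theorem HasChi.of_homeomorph {Y : Type*} [TopologicalSpace Y] (e : Y ≃ₜ X) (hX : HasChi K X m) :
    HasChi K Y m := by
  have h := HasChi.closed (K := K) (U := Empty) (j := Empty.elim) e.isClosedEmbedding
    (.of_isEmpty _) (by
    rw [Set.range_eq_empty, e.surjective.range_eq, Set.compl_univ]) hX .of_isEmpty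
  simpa using h

end

end AlexanderSpanier

namespace AlexanderSpanier

/-! ### Half-spaces, points and real vector spaces -/

open scoped NNReal

section

variable {K : Type*} [Field K] {X : Type*} [MetricSpace X] {q : ℕ}

/-- The translation of the half-line factor. -/
def shift (s : ℝ≥0) (p : X × ℝ≥0) : X × ℝ≥0 := (p.1, p.2 + s)

theorem dist_shift_shift (s : ℝ≥0) (p p' : X × ℝ≥0) : dist (shift s p) (shift s p') = dist p p' := by
  simp [shift, Prod.dist_eq, NNReal.dist_eq]

theorem dist_shift_add (s η : ℝ≥0) (p : X × ℝ≥0) : dist (shift s p) (shift (s + η) p) = η := by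
  simp [shift, Prod.dist_eq, NNReal.dist_eq]

theorem le_dist_shift (x : X) (s : ℝ≥0) (p : X × ℝ≥0) : s ≤ dist (shift s p) (x, 0) := by
  simp only [shift, Prod.dist_eq, NNReal.dist_eq, le_max_iff]
  right
  rw [NNReal.coe_zero, sub_zero, NNReal.abs_eq, NNReal.coe_add]
  exact le_add_of_nonneg_left p.2.2

theorem dist_le_dist_shift (x : X) (s : ℝ≥0) (p : X × ℝ≥0) :
    dist p (x, 0) ≤ dist (shift s p) (x, 0) := by
  simp only [shift, Prod.dist_eq, NNReal.dist_eq]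
  refine max_le_max le_rfl ?_
  rw [NNReal.coe_zero, sub_zero, sub_zero, NNReal.abs_eq, NNReal.abs_eq, NNReal.coe_add]
  exact le_add_of_nonneg_right s.2

/-- The coboundary of a truncated cocycle vanishes on all tuples of uniformly small diameter. -/
theorem exists_pos_delta_cut_eq_zero {Y : Type*} [PseudoMetricSpace Y] {φ : Cochain K Y q}
    {W C : Set Y} (hC : IsCompact C) (hWC : W ⊆ C)
    (h : delta K Y q (cut W φ) ∈ zeroCochains K Y (q + 1)) :
    ∃ ε > 0, ∀ t : Fin (q + 2) → Y, (∀ i j, dist (t i) (t j) < ε) →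
      delta K Y q (cut W φ) t = 0 := by
  have h' : ∀ y : Y, ∃ U : Set Y, IsOpen U ∧ y ∈ U ∧ ∀ t : Fin (q + 2) → Y, (∀ i, t i ∈ U) →
      delta K Y q (cut W φ) t = 0 := fun y => by
    obtain ⟨U, hU, hU'⟩ := mem_zeroCochains.mp h y
    obtain ⟨O, hOU, hO, hy⟩ := mem_nhds_iff.mp hU
    exact ⟨O, hO, hy, fun t ht => hU' t fun i => hOU (ht i)⟩
  choose U hU hyU hU' using h'
  -- A Lebesgue number handles tuples meeting `C`; on any other tuple all faces leave `W`, so the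
  -- truncated cochain is zero on each of them.
  obtain ⟨ε, hε, hε'⟩ := lebesgue_number_lemma_of_metric hC hU
    fun y _ => Set.mem_iUnion.mpr ⟨y, hyU y⟩
  refine ⟨ε, hε, fun t ht => ?_⟩
  by_cases hc : ∃ i, t i ∈ C
  · obtain ⟨i, hi⟩ := hc
    obtain ⟨y, hy⟩ := hε' (t i) hi
    exact hU' y t fun j => hy (ht j i)
  · rw [delta_apply]
    refine Finset.sum_eq_zero fun i _ => ?_
    have : cut W φ (t ∘ i.succAbove) = 0 := cut_of_notMem 0 fun hW => hc ⟨_, hWC hW⟩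
    rw [this, mul_zero]

/-- Translations along the half-line carry everything out of a given ball. A single prism to the far
translate would involve tuples of large diameter, on which a cocycle need not vanish. The push is
therefore split into many short translations whose prism identities telescope. -/
theorem subsingleton_halfSpace [ProperSpace X] [Nonempty X] (q : ℕ) :
    Subsingleton (CompactCohomology K (X × ℝ≥0) q) := by
  refine PairCohomology.subsingleton_H_iff.mpr fun φ hφ => ?_
  obtain ⟨x⟩ := ‹Nonempty X›
  obtain ⟨R, hR⟩ := (IsCompact.isBounded hφ.1).subset_ball ((x, 0) : X × ℝ≥0)
  -- After truncation the cochain vanishes on every tuple with an entry outside the ball, not merely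
  -- locally.
  set W := Metric.ball ((x, 0) : X × ℝ≥0) R with hW
  have hsub : cut W φ - φ ∈ zeroCochains K (X × ℝ≥0) q := by
    refine mem_zeroCochains.mpr fun y => vanishesNear_cut_sub ?_
    by_cases hy : y ∈ supp φ
    · exact Or.inl (Metric.isOpen_ball.mem_nhds (hR hy))
    · exact Or.inr (vanishesNear_of_notMem_supp hy)
  have hδ : delta K _ q (cut W φ) ∈ zeroCochains K (X × ℝ≥0) (q + 1) := by
    have := add_mem (delta_mem_zeroCochains hsub) hφ.2
    rwa [← map_add, sub_add_cancel] at this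
  suffices h : cut W φ ∈ PairCohomology.bdry (delta K (X × ℝ≥0)) (compactCochains K (X × ℝ≥0))
      (zeroCochains K (X × ℝ≥0)) q by
    have := sub_mem h (PairCohomology.le_bdry q hsub)
    rwa [sub_sub_cancel] at this
  obtain ⟨ε, hε, hε'⟩ := exists_pos_delta_cut_eq_zero (isCompact_closedBall _ R)
    Metric.ball_subset_closedBall hδ
  set ψ := cut W φ with hψ
  have hψW : ∀ (t : Fin (q + 1) → X × ℝ≥0) (i), t i ∉ W → ψ t = 0 := fun t i h =>
    cut_of_notMem i h
  -- Entries of a prism tuple lie within ε/3 of translates of points of one ball of radius ε/6;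
  -- those translates are less than ε/3 apart, so the tuple has diameter less than ε.
  obtain ⟨η, hη⟩ : ∃ η : ℝ≥0, (η : ℝ) = ε / 3 := ⟨⟨ε / 3, by positivity⟩, rfl⟩
  let f : ℕ → X × ℝ≥0 → X × ℝ≥0 := fun n => shift (n * η)
  have hf : ∀ n p, dist (f n p) (f (n + 1) p) = ε / 3 := fun n p => by
    have := dist_shift_add (n * η) η p
    simp only [f]
    rw [← hη, ← this]
    push_cast
    rw [add_mul, one_mul]
  obtain ⟨N, hN⟩ : ∃ N : ℕ, R < N * η := by
    obtain ⟨N, hN⟩ := exists_nat_gt (R / η)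
    exact ⟨N, by rwa [div_lt_iff₀ (by rw [hη]; positivity)] at hN⟩
  have h0 : pull K (f 0) q ψ = ψ := by
    have : f 0 = id := funext fun p => by simp [f, shift]
    rw [this]
    rfl
  have hNz : pull K (f N) q ψ = 0 := funext fun t => hψW _ 0 fun hc => by
    have h₁ := le_dist_shift x (N * η) (t 0)
    have h₂ : dist (shift (N * η) (t 0)) (x, 0) < R := hc
    push_cast at h₁
    linarith
  have hpz : ∀ n, prism (f n) (f (n + 1)) q (delta K _ q ψ) ∈ zeroCochains K (X × ℝ≥0) q := by
    refine fun n => mem_zeroCochains.mpr fun y => ⟨Metric.ball y (ε / 6),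
      Metric.ball_mem_nhds _ (by positivity), fun t ht => prism_eq_zero _ _ _ _ _ fun u hu =>
        hε' u fun i j => ?_⟩
    have key : ∀ a b, dist (f n (t a)) (f n (t b)) < ε / 3 := fun a b => by
      rw [dist_shift_shift]
      have h₁ := ht a
      have h₂ := ht b
      have := dist_triangle_right (t a) (t b) y
      rw [Metric.mem_ball] at h₁ h₂
      linarith
    have key' : ∀ i, ∃ a, dist (u i) (f n (t a)) ≤ ε / 3 := fun i => by
      obtain ⟨a, ha | ha⟩ := hu i
      · exact ⟨a, by rw [ha, dist_self]; positivity⟩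
      · exact ⟨a, by rw [ha, dist_comm, hf]⟩
    obtain ⟨a, ha⟩ := key' i
    obtain ⟨b, hb⟩ := key' j
    have h₁ := dist_triangle4_right (u i) (u j) (f n (t a)) (f n (t b))
    have h₂ := key a b
    linarith
  cases q with
  | zero =>
    have hsum : ∑ n ∈ Finset.range N, prism (f n) (f (n + 1)) 0 (delta K _ 0 ψ) = -ψ := by
      simp only [prism_delta_zero]
      rw [Finset.sum_range_sub (fun n => pull K (f n) 0 ψ), hNz, h0, zero_sub]
    have := neg_mem (sum_mem fun n (_ : n ∈ Finset.range N) => hpz n)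
    rwa [hsum, neg_neg] at this
  | succ q =>
    have hsum : delta K _ q (∑ n ∈ Finset.range N, prism (f n) (f (n + 1)) q ψ) +
        ∑ n ∈ Finset.range N, prism (f n) (f (n + 1)) (q + 1) (delta K _ (q + 1) ψ) = -ψ := by
      rw [map_sum, ← Finset.sum_add_distrib]
      simp only [delta_prism]
      rw [Finset.sum_range_sub (fun n => pull K (f n) (q + 1) ψ), hNz, h0, zero_sub]
    refine PairCohomology.mem_bdry_succ.mpr
      ⟨-∑ n ∈ Finset.range N, prism (f n) (f (n + 1)) q ψ, neg_mem (sum_mem fun n _ => ?_), ?_⟩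
    -- Translation does not decrease the distance to the base point on the boundary, so a tuple
    -- starting outside the closed ball stays outside and the prism keeps compact support.
    · refine mem_compactCochains_of_vanishesNear (isCompact_closedBall (x, 0) R) fun y hy =>
        ⟨_, Metric.isClosed_closedBall.isOpen_compl.mem_nhds hy, fun t ht =>
          prism_eq_zero _ _ _ _ _ fun u hu => hψW u 0 fun hc => ?_⟩
      obtain ⟨a, ha⟩ := hu 0
      refine ht a (Metric.mem_closedBall.mpr ?_)
      rw [hW, Metric.mem_ball] at hc
      rcases ha with ha | ha
      all_goals
        rw [ha] at hc
        exact (dist_le_dist_shift x _ (t a)).trans hc.le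
    · have := neg_mem (sum_mem fun n (_ : n ∈ Finset.range N) => hpz n)
      rw [map_neg, sub_neg_eq_add]
      convert this using 1
      exact eq_neg_of_add_eq_zero_left (by rw [add_assoc, hsum, add_neg_cancel])

theorem isOpenEmbedding_exp : IsOpenEmbedding fun p : X × ℝ =>
    ((p.1, ⟨Real.exp p.2, (Real.exp_pos _).le⟩) : X × ℝ≥0) := by
  have h : IsOpenEmbedding fun t : ℝ => (⟨Real.exp t, (Real.exp_pos _).le⟩ : ℝ≥0) := by
    have he : IsEmbedding fun t : ℝ => (⟨Real.exp t, (Real.exp_pos _).le⟩ : ℝ≥0) :=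
      .of_comp (by fun_prop) NNReal.continuous_coe Real.isOpenEmbedding_exp.isEmbedding
    refine ⟨he, ?_⟩
    have hr : Set.range (fun t : ℝ => (⟨Real.exp t, (Real.exp_pos _).le⟩ : ℝ≥0)) = Set.Ioi 0 := by
      refine Set.ext fun t => ⟨?_, fun ht => ⟨Real.log t, NNReal.eq (Real.exp_log ht)⟩⟩
      rintro ⟨u, rfl⟩
      exact Real.exp_pos u
    rw [hr]
    exact isOpen_Ioi
  exact IsOpenEmbedding.id.prodMap h

/-- Via `exp`, X × ℝ is the open complement of X × {0} in the acyclic half-space, so its Euler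
characteristic is 0 - n. -/
theorem HasChi.prod_real [ProperSpace X] [Nonempty X] {n : ℤ} (h : HasChi K X n) :
    HasChi K (X × ℝ) (-n) := by
  have hi : IsClosedEmbedding fun x : X => (x, (0 : ℝ≥0)) :=
    Function.LeftInverse.isClosedEmbedding (f := Prod.fst) (fun _ => rfl) continuous_fst
      (by fun_prop)
  have := HasChi.open hi isOpenEmbedding_exp ?_ (.of_subsingleton subsingleton_halfSpace) h
  · simpa using this
  · ext ⟨x, t⟩
    constructor
    · rintro ⟨⟨y, u⟩, hu⟩ ⟨z, hz⟩
      have h₁ := congrArg (fun p => (p.2 : ℝ)) (hu.trans hz.symm)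
      exact (Real.exp_pos u).ne' h₁
    · intro ht
      have hpos : 0 < t := pos_iff_ne_zero.mpr fun hc => ht ⟨x, by rw [hc]⟩
      exact ⟨(x, Real.log t), Prod.ext rfl (NNReal.eq (Real.exp_log hpos))⟩

end

/-! ### The point and Euclidean spaces -/

section

variable {K : Type*} [Field K]

theorem mem_zeroCochains_of_unique {X : Type*} [TopologicalSpace X] [Unique X] {q : ℕ}
    {φ : Cochain K X q} : φ ∈ zeroCochains K X q ↔ φ = 0 := by
  refine ⟨fun h => ?_, fun h => h ▸ zero_mem _⟩
  obtain ⟨U, hU, hU'⟩ := mem_zeroCochains.mp h default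
  funext t
  exact hU' t fun i => Subsingleton.elim default (t i) ▸ mem_of_mem_nhds hU

theorem delta_apply_of_unique {X : Type*} [Unique X] {q : ℕ} (φ : Cochain K X q)
    (t : Fin (q + 2) → X) : delta K X q φ t = if Even q then 0 else φ default := by
  have h : ∀ i : Fin (q + 2), φ (t ∘ i.succAbove) = φ default := fun i =>
    congrArg φ (Subsingleton.elim _ _)
  simp only [delta_apply, h, ← Finset.sum_mul, Fin.sum_neg_one_pow, Nat.even_add, even_two,
    iff_true]
  split_ifs <;> simp

/-- Over a point the complex is K in every degree, with differentials alternately 0 and the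
identity, starting with 0. Only degree 0 survives. -/
theorem hasChi_unique (X : Type*) [TopologicalSpace X] [Unique X] : HasChi K X 1 := by
  have hc : ∀ q (φ : Cochain K X q), φ ∈ compactCochains K X q := fun q φ =>
    (Set.toFinite (supp φ)).isCompact
  have hsub : ∀ q, Subsingleton (CompactCohomology K X (q + 1)) := fun q => by
    refine PairCohomology.subsingleton_H_iff.mpr fun φ hφ => ?_
    rcases Nat.even_or_odd q with hq | hq
    · have h₁ := congrFun (mem_zeroCochains_of_unique.mp hφ.2) default
      rw [delta_apply_of_unique, if_neg (by simpa [Nat.even_add_one] using hq)] at h₁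
      have h₂ : φ = 0 := funext fun t => (congrArg φ (Subsingleton.elim _ _)).trans h₁
      rw [h₂]
      exact zero_mem _
    · refine PairCohomology.mem_bdry_succ.mpr
        ⟨fun _ => φ default, hc q _, mem_zeroCochains_of_unique.mpr ?_⟩
      funext t
      rw [Pi.sub_apply, delta_apply_of_unique, if_neg (Nat.not_even_iff_odd.mpr hq),
        Subsingleton.elim t default, sub_self, Pi.zero_apply]
  have e : CompactCohomology K X 0 ≃ₗ[K] K := by
    refine LinearEquiv.ofBijective (Submodule.liftQ _
      ((LinearMap.proj (default : Fin 1 → X)).comp (Submodule.subtype _)) fun φ hφ => ?_)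
      ⟨?_, fun a => ?_⟩
    · exact congrFun (mem_zeroCochains_of_unique.mp hφ) default
    · rw [injective_iff_map_eq_zero]
      intro y hy
      obtain ⟨φ, rfl⟩ := Submodule.Quotient.mk_surjective _ y
      refine PairCohomology.subquotient_mk_eq_zero.mpr (mem_zeroCochains_of_unique.mpr ?_)
      exact funext fun t => (congrArg φ.1 (Subsingleton.elim _ _)).trans hy
    · refine ⟨Submodule.Quotient.mk ⟨fun _ => a, hc 0 _, mem_zeroCochains_of_unique.mpr ?_⟩, rfl⟩
      funext t
      rw [delta_apply_of_unique, if_pos Even.zero, Pi.zero_apply]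
  refine ⟨⟨?_, 1, ?_⟩, ?_⟩
  · rintro (_ | q)
    · exact Module.Finite.equiv e.symm
    · have := hsub q
      infer_instance
  · rintro (_ | q) hq
    · omega
    · exact hsub q
  · rw [finsum_eq_single _ 0, e.finrank_eq]
    · simp
    · rintro (_ | q) hq
      · exact absurd rfl hq
      · have := hsub q
        simp [Module.finrank_zero_of_subsingleton]

theorem hasChi_pi (n : ℕ) : HasChi K (Fin n → ℝ) ((-1) ^ n) := by
  induction n with
  | zero => simpa using hasChi_unique (Fin 0 → ℝ)
  | succ n ih =>
    have e : (Fin (n + 1) → ℝ) ≃L[ℝ] (Fin n → ℝ) × ℝ := .ofFinrankEq (by simp)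
    have := HasChi.of_homeomorph e.toHomeomorph ih.prod_real
    simpa [pow_succ] using this

theorem hasChi_normedSpace (E : Type*) [NormedAddCommGroup E] [NormedSpace ℝ E]
    [FiniteDimensional ℝ E] : HasChi K E ((-1) ^ Module.finrank ℝ E) := by
  have e : E ≃L[ℝ] (Fin (Module.finrank ℝ E) → ℝ) := .ofFinrankEq (by simp)
  exact (hasChi_pi _).of_homeomorph e.toHomeomorph

end

end AlexanderSpanier

namespace AlexanderSpanier

/-! ### Level sets -/

section

variable {K : Type*} [Field K]

/-- Additivity twice: first remove {v < u} from X, then remove {u < v} from the closed set {u ≤ v}.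
-/
theorem HasChi.setOf_eq {X : Type*} [MetricSpace X] [LocallyCompactSpace X] {u v : X → ℝ}
    (hu : Continuous u) (hv : Continuous v) {m a b : ℤ} (hX : HasChi K X m)
    (ha : HasChi K {x | u x < v x} a) (hb : HasChi K {x | v x < u x} b) :
    HasChi K {x | u x = v x} (m - b - a) := by
  have hle : IsClosed {x | u x ≤ v x} := isClosed_le hu hv
  have h₁ : HasChi K {x | u x ≤ v x} (m - b) := by
    refine HasChi.closed hle.isClosedEmbedding_subtypeVal
      (isOpen_lt hv hu).isOpenEmbedding_subtypeVal ?_ hX hb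
    rw [Subtype.range_coe, Subtype.range_coe]
    ext x
    simp
  have : LocallyCompactSpace {x | u x ≤ v x} := hle.locallyCompactSpace
  have hi : {x | u x = v x} ⊆ {x | u x ≤ v x} := fun x hx => le_of_eq hx
  have hj : {x | u x < v x} ⊆ {x | u x ≤ v x} := fun x (hx : u x < v x) => hx.le
  refine HasChi.closed (i := Set.inclusion hi) (j := Set.inclusion hj)
    ⟨.inclusion hi, ?_⟩ ⟨.inclusion hj, ?_⟩ ?_ h₁ ha
  · rw [Set.range_inclusion]
    exact (isClosed_eq hu hv).preimage continuous_subtype_val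
  · rw [Set.range_inclusion]
    exact (isOpen_lt hu hv).preimage continuous_subtype_val
  · rw [Set.range_inclusion, Set.range_inclusion]
    ext ⟨x, hx⟩
    simp only [Set.mem_ofPred_eq, Set.mem_compl_iff] at hx ⊢
    exact ⟨fun h => h.ne, fun h => lt_of_le_of_ne hx h⟩

/-! ### Regions bounded by a radius function -/

variable {E F : Type*} [NormedAddCommGroup E] [NormedSpace ℝ E] [NormedAddCommGroup F]
  [NormedSpace ℝ F] {ρ : F → ℝ}

/-- The radial dilation onto the complement of `{0} × F`. -/
noncomputable def radialShift (hρ : Continuous ρ) (hρ0 : ∀ y, 0 ≤ ρ y) :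
    OpenPartialHomeomorph (E × F) (E × F) where
  -- The direction of x is kept and its norm is lowered by ρ(y); the inverse raises it by ρ(y).
  toFun p := ((1 - ρ p.2 / ‖p.1‖) • p.1, p.2)
  invFun p := ((1 + ρ p.2 / ‖p.1‖) • p.1, p.2)
  source := {p | ρ p.2 < ‖p.1‖}
  target := {p | p.1 ≠ 0}
  map_source' := by
    rintro ⟨x, y⟩ (h : ρ y < ‖x‖)
    have hx : 0 < ‖x‖ := (hρ0 y).trans_lt h
    exact smul_ne_zero (sub_pos.mpr ((div_lt_one hx).mpr h)).ne' (norm_pos_iff.mp hx)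
  map_target' := by
    rintro ⟨x, y⟩ (h : x ≠ 0)
    have hx : 0 < ‖x‖ := norm_pos_iff.mpr h
    have h₁ : 0 ≤ ρ y / ‖x‖ := div_nonneg (hρ0 y) hx.le
    change ρ y < ‖(1 + ρ y / ‖x‖) • x‖
    rw [norm_smul, Real.norm_of_nonneg (by positivity), add_mul, div_mul_cancel₀ _ hx.ne']
    linarith
  left_inv' := by
    rintro ⟨x, y⟩ (h : ρ y < ‖x‖)
    have hx : 0 < ‖x‖ := (hρ0 y).trans_lt h
    have h₁ : 0 < 1 - ρ y / ‖x‖ := sub_pos.mpr ((div_lt_one hx).mpr h)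
    refine Prod.ext ?_ rfl
    change (1 + ρ y / ‖(1 - ρ y / ‖x‖) • x‖) • (1 - ρ y / ‖x‖) • x = x
    rw [norm_smul, Real.norm_of_nonneg h₁.le, smul_smul]
    convert one_smul ℝ x
    have h₂ : ‖x‖ - ρ y ≠ 0 := (sub_pos.mpr h).ne'
    have h₃ : 1 - ρ y / ‖x‖ = (‖x‖ - ρ y) / ‖x‖ := by field_simp
    rw [h₃]
    field_simp
    ring
  right_inv' := by
    rintro ⟨x, y⟩ (h : x ≠ 0)
    have hx : 0 < ‖x‖ := norm_pos_iff.mpr h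
    have h₀ := hρ0 y
    have h₁ : 0 < 1 + ρ y / ‖x‖ := by positivity
    refine Prod.ext ?_ rfl
    change (1 - ρ y / ‖(1 + ρ y / ‖x‖) • x‖) • (1 + ρ y / ‖x‖) • x = x
    rw [norm_smul, Real.norm_of_nonneg h₁.le, smul_smul]
    convert one_smul ℝ x
    have h₂ : ‖x‖ + ρ y ≠ 0 := by positivity
    have h₃ : 1 + ρ y / ‖x‖ = (‖x‖ + ρ y) / ‖x‖ := by field_simp
    rw [h₃]
    field_simp
    ring
  open_source := isOpen_lt (by fun_prop) (by fun_prop)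
  open_target := isOpen_ne_fun continuous_fst continuous_const
  continuousOn_toFun := by
    refine ContinuousOn.prodMk (ContinuousOn.smul (continuousOn_const.sub
      (ContinuousOn.div (by fun_prop) (by fun_prop) ?_)) (by fun_prop)) (by fun_prop)
    rintro ⟨x, y⟩ (h : ρ y < ‖x‖)
    exact ((hρ0 y).trans_lt h).ne'
  continuousOn_invFun := by
    refine ContinuousOn.prodMk (ContinuousOn.smul (continuousOn_const.add
      (ContinuousOn.div (by fun_prop) (by fun_prop) ?_)) (by fun_prop)) (by fun_prop)
    rintro ⟨x, y⟩ (h : x ≠ 0)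
    exact norm_ne_zero_iff.mpr h

/-- A family of open balls of positive radii is a trivial bundle. -/
noncomputable def ballBundleHomeomorph (hρ : Continuous ρ) (hρ0 : ∀ y, 0 < ρ y) :
    {p : E × F | ‖p.1‖ < ρ p.2} ≃ₜ E × F where
  -- On norms this is t ↦ t / (ρ - t), from [0, ρ) onto [0, ∞), with inverse u ↦ ρu / (1 + u).
  toFun p := ((ρ p.1.2 - ‖p.1.1‖)⁻¹ • p.1.1, p.1.2)
  invFun p := ⟨((ρ p.2 / (1 + ‖p.1‖)) • p.1, p.2), by
    have h₀ := hρ0 p.2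
    change ‖(ρ p.2 / (1 + ‖p.1‖)) • p.1‖ < ρ p.2
    rw [norm_smul, Real.norm_of_nonneg (by positivity), div_mul_eq_mul_div,
      div_lt_iff₀ (by positivity)]
    linarith⟩
  left_inv := by
    rintro ⟨⟨x, y⟩, (h : ‖x‖ < ρ y)⟩
    have h₁ : 0 < ρ y - ‖x‖ := sub_pos.mpr h
    refine Subtype.ext (Prod.ext ?_ rfl)
    change (ρ y / (1 + ‖(ρ y - ‖x‖)⁻¹ • x‖)) • (ρ y - ‖x‖)⁻¹ • x = x
    rw [norm_smul, Real.norm_of_nonneg (by positivity), smul_smul]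
    convert one_smul ℝ x
    have h₀ := (hρ0 y).ne'
    have h₂ : 1 + (ρ y - ‖x‖)⁻¹ * ‖x‖ = ρ y / (ρ y - ‖x‖) := by
      field_simp
      ring
    rw [h₂]
    field_simp
  right_inv := by
    rintro ⟨x, y⟩
    have h₀ := hρ0 y
    refine Prod.ext ?_ rfl
    change (ρ y - ‖(ρ y / (1 + ‖x‖)) • x‖)⁻¹ • (ρ y / (1 + ‖x‖)) • x = x
    rw [norm_smul, Real.norm_of_nonneg (by positivity), smul_smul]
    convert one_smul ℝ x
    have h₂ : ρ y - ρ y / (1 + ‖x‖) * ‖x‖ = ρ y / (1 + ‖x‖) := by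
      field_simp
      ring
    rw [h₂]
    exact inv_mul_cancel₀ (by positivity)
  continuous_toFun := by
    refine Continuous.prodMk (Continuous.smul (Continuous.inv₀ (by fun_prop) ?_) (by fun_prop))
      (by fun_prop)
    exact fun p => (sub_pos.mpr p.2).ne'
  continuous_invFun := by
    refine Continuous.subtype_mk (Continuous.prodMk (Continuous.smul
      (Continuous.div (by fun_prop) (by fun_prop) fun p => ?_) (by fun_prop)) (by fun_prop)) _
    positivity

variable [FiniteDimensional ℝ E] [FiniteDimensional ℝ F]

/-- By the radial shift this is the Euler characteristic of the complement of {0} × F in E × F. -/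
theorem hasChi_lt_norm (hρ : Continuous ρ) (hρ0 : ∀ y, 0 ≤ ρ y) :
    HasChi K {p : E × F | ρ p.2 < ‖p.1‖}
      ((-1) ^ (Module.finrank ℝ E + Module.finrank ℝ F) - (-1) ^ Module.finrank ℝ F) := by
  have hX : HasChi K (E × F) ((-1) ^ (Module.finrank ℝ E + Module.finrank ℝ F)) := by
    simpa using hasChi_normedSpace (K := K) (E × F)
  let e : OpenPartialHomeomorph (E × F) (E × F) := radialShift hρ hρ0
  have hi : IsClosedEmbedding fun y : F => ((0 : E), y) :=
    Function.LeftInverse.isClosedEmbedding (f := Prod.snd) (fun _ => rfl) continuous_snd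
      (by fun_prop)
  have hj : IsOpenEmbedding fun p : e.source => (e.toHomeomorphSourceTarget p : E × F) :=
    e.open_target.isOpenEmbedding_subtypeVal.comp e.toHomeomorphSourceTarget.isOpenEmbedding
  refine HasChi.open hi hj ?_ hX (hasChi_normedSpace F)
  have h₁ : Set.range (fun p : e.source => (e.toHomeomorphSourceTarget p : E × F)) = e.target := by
    have := e.toHomeomorphSourceTarget.surjective.range_comp (Subtype.val : e.target → E × F)
    rwa [Subtype.range_coe] at this
  refine h₁.trans (Set.ext ?_)
  rintro ⟨x, y⟩
  change x ≠ 0 ↔ _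
  simp [eq_comm]

theorem hasChi_norm_lt (hρ : Continuous ρ) (hρ0 : ∀ y, 0 < ρ y) :
    HasChi K {p : E × F | ‖p.1‖ < ρ p.2}
      ((-1) ^ (Module.finrank ℝ E + Module.finrank ℝ F)) := by
  have hX : HasChi K (E × F) ((-1) ^ (Module.finrank ℝ E + Module.finrank ℝ F)) := by
    simpa using hasChi_normedSpace (K := K) (E × F)
  exact hX.of_homeomorph (ballBundleHomeomorph hρ hρ0)

theorem hasChi_norm_eq (hρ : Continuous ρ) (hρ0 : ∀ y, 0 < ρ y) :
    HasChi K {p : E × F | ‖p.1‖ = ρ p.2}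
      ((-1) ^ Module.finrank ℝ F - (-1) ^ (Module.finrank ℝ E + Module.finrank ℝ F)) := by
  have hX : HasChi K (E × F) ((-1) ^ (Module.finrank ℝ E + Module.finrank ℝ F)) := by
    simpa using hasChi_normedSpace (K := K) (E × F)
  convert HasChi.setOf_eq (u := fun p : E × F => ‖p.1‖) (v := fun p => ρ p.2) (by fun_prop)
    (by fun_prop) hX (hasChi_norm_lt hρ hρ0) (hasChi_lt_norm hρ fun y => (hρ0 y).le) using 1
  ring

/-- Here the radius vanishes at the origin, so the trivialisation by open balls is unavailable. Both
sides of the cone are instead treated as exteriors, the second after exchanging E and F. -/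
theorem hasChi_norm_eq_norm :
    HasChi K {p : E × F | ‖p.1‖ = ‖p.2‖}
      ((-1) ^ Module.finrank ℝ E + (-1) ^ Module.finrank ℝ F -
        (-1) ^ (Module.finrank ℝ E + Module.finrank ℝ F)) := by
  have hX : HasChi K (E × F) ((-1) ^ (Module.finrank ℝ E + Module.finrank ℝ F)) := by
    simpa using hasChi_normedSpace (K := K) (E × F)
  have h₁ : HasChi K {p : E × F | ‖p.1‖ < ‖p.2‖}
      ((-1) ^ (Module.finrank ℝ F + Module.finrank ℝ E) - (-1) ^ Module.finrank ℝ E) := by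
    have hopen : IsOpen {p : F × E | ‖p.2‖ < ‖p.1‖} := isOpen_lt (by fun_prop) (by fun_prop)
    have : LocallyCompactSpace {p : F × E | ‖p.2‖ < ‖p.1‖} := hopen.locallyCompactSpace
    exact (hasChi_lt_norm (ρ := fun x : E => ‖x‖) continuous_norm norm_nonneg).of_homeomorph
      ((Homeomorph.prodComm E F).subtype fun _ => Iff.rfl)
  convert HasChi.setOf_eq (u := fun p : E × F => ‖p.1‖) (v := fun p => ‖p.2‖) (by fun_prop)
    (by fun_prop) hX h₁ (hasChi_lt_norm (ρ := fun y : F => ‖y‖) continuous_norm norm_nonneg) using 1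
  ring

end

end AlexanderSpanier

/-! ### Reduction of the fibres to quadrics -/

namespace Brieskorn

open AlexanderSpanier

theorem strictMono_mul_abs_pow (m : ℕ) : StrictMono fun x : ℝ => x * |x| ^ m := by
  have hpos : StrictMonoOn (fun x : ℝ => x * |x| ^ m) (Set.Ici 0) := by
    intro x hx y hy hxy
    have hx' : (0 : ℝ) ≤ x := hx
    change x * |x| ^ m < y * |y| ^ m
    rw [abs_of_nonneg hx', abs_of_nonneg (hx'.trans hxy.le), ← pow_succ', ← pow_succ']
    exact pow_lt_pow_left₀ hxy hx' (Nat.succ_ne_zero m)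
  exact strictMono_of_odd_strictMonoOn_nonneg (fun x => by simp) hpos

theorem surjective_mul_abs_pow (m : ℕ) : Function.Surjective fun x : ℝ => x * |x| ^ m := by
  have hpos : ∀ y : ℝ, 0 ≤ y → ∃ x : ℝ, x * |x| ^ m = y := fun y hy => by
    refine ⟨y ^ ((m + 1 : ℕ) : ℝ)⁻¹, ?_⟩
    rw [abs_of_nonneg (by positivity), ← pow_succ', Real.rpow_inv_natCast_pow hy m.succ_ne_zero]
  intro y
  rcases le_total 0 y with hy | hy
  · exact hpos y hy
  · obtain ⟨x, hx⟩ := hpos (-y) (neg_nonneg.mpr hy)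
    exact ⟨-x, by simp [hx]⟩

/-- The homeomorphism `x ↦ x |x| ^ m` of the real line. -/
noncomputable def powHomeomorph (m : ℕ) : ℝ ≃ₜ ℝ :=
  ((strictMono_mul_abs_pow m).orderIsoOfSurjective _ (surjective_mul_abs_pow m)).toHomeomorph

/-- Squaring x|x|^m gives exponent 2(m + 1), which is 2^k for m = 2^(k-1) - 1; this is where k ≥ 1
enters. -/
theorem powHomeomorph_apply_sq {k : ℕ} (hk : 1 ≤ k) (x : ℝ) :
    powHomeomorph (2 ^ (k - 1) - 1) x ^ 2 = x ^ 2 ^ k := by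
  obtain ⟨k, rfl⟩ := Nat.exists_eq_add_of_le' hk
  have h₁ : powHomeomorph (2 ^ (k + 1 - 1) - 1) x = x * |x| ^ (2 ^ k - 1) := rfl
  rw [h₁, mul_pow, ← sq_abs x, ← mul_pow, ← pow_succ', Nat.sub_add_cancel Nat.one_le_two_pow,
    ← pow_mul, ← pow_succ, Even.pow_abs]
  exact Nat.even_pow.mpr ⟨even_two, k.succ_ne_zero⟩

variable {d : ℕ} (k A B : Fin d → ℕ)

/-- The change of variables turning the polynomial into a quadratic form. -/
noncomputable def quadricHomeomorph : (Var A B → ℝ) ≃ₜ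
    EuclideanSpace ℝ (Σ r, Fin (A r)) × EuclideanSpace ℝ (Σ r, Fin (B r)) where
  toFun p := (WithLp.toLp 2 fun v => powHomeomorph (2 ^ (k v.1 - 1) - 1) (p ⟨v.1, Sum.inl v.2⟩),
    WithLp.toLp 2 fun v => powHomeomorph (2 ^ (k v.1 - 1) - 1) (p ⟨v.1, Sum.inr v.2⟩))
  invFun z v := (powHomeomorph (2 ^ (k v.1 - 1) - 1)).symm
    (v.2.elim (fun i => z.1 ⟨v.1, i⟩) (fun j => z.2 ⟨v.1, j⟩))
  left_inv p := by
    funext ⟨r, i⟩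
    rcases i with i | i <;> simp
  right_inv z := by
    refine Prod.ext ?_ ?_ <;> ext v <;> simp
  continuous_toFun := by fun_prop
  continuous_invFun := by
    refine continuous_pi fun ⟨r, i⟩ => ?_
    rcases i with i | i <;> dsimp only [Sum.elim_inl, Sum.elim_inr] <;> fun_prop

theorem eval_poly (hk1 : ∀ r, 1 ≤ k r) (p : Var A B → ℝ) :
    MvPolynomial.eval p (poly k A B) =
      ‖(quadricHomeomorph k A B p).1‖ ^ 2 - ‖(quadricHomeomorph k A B p).2‖ ^ 2 := by
  rw [EuclideanSpace.real_norm_sq_eq, EuclideanSpace.real_norm_sq_eq, Fintype.sum_sigma,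
    Fintype.sum_sigma, ← Finset.sum_sub_distrib]
  simp only [poly, P, map_sum, map_sub, map_pow, MvPolynomial.eval_X]
  refine Finset.sum_congr rfl fun r _ => ?_
  simp only [quadricHomeomorph, Homeomorph.homeomorph_mk_coe, Equiv.coe_fn_mk,
    powHomeomorph_apply_sq (hk1 r)]

theorem finrank_sigma (A : Fin d → ℕ) :
    Module.finrank ℝ (EuclideanSpace ℝ (Σ r, Fin (A r))) = ∑ r, A r := by
  simp

variable (K : Type*) [Field K]

theorem hasChi_fiber_zero (hk1 : ∀ r, 1 ≤ k r) : HasChi K (fiber k A B 0)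
    ((-1) ^ (∑ r, A r) + (-1) ^ (∑ r, B r) - (-1) ^ (∑ r, A r + ∑ r, B r)) := by
  have h := hasChi_norm_eq_norm (K := K) (E := EuclideanSpace ℝ (Σ r, Fin (A r)))
    (F := EuclideanSpace ℝ (Σ r, Fin (B r)))
  rw [finrank_sigma, finrank_sigma] at h
  have hc : IsClosed {p : EuclideanSpace ℝ (Σ r, Fin (A r)) × EuclideanSpace ℝ (Σ r, Fin (B r)) |
    ‖p.1‖ = ‖p.2‖} := isClosed_eq (by fun_prop) (by fun_prop)
  have := hc.locallyCompactSpace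
  refine h.of_homeomorph ((quadricHomeomorph k A B).subtype fun p => ?_)
  change MvPolynomial.eval p (poly k A B) = 0 ↔ _ = _
  rw [eval_poly k A B hk1, sub_eq_zero, sq_eq_sq₀ (norm_nonneg _) (norm_nonneg _)]

/-- The equation |x|² - |y|² = 1 is |x| = √(1 + |y|²), with a strictly positive radius function of
y. -/
theorem hasChi_fiber_one (hk1 : ∀ r, 1 ≤ k r) : HasChi K (fiber k A B 1)
    ((-1) ^ (∑ r, B r) - (-1) ^ (∑ r, A r + ∑ r, B r)) := by
  have hρ : Continuous fun y : EuclideanSpace ℝ (Σ r, Fin (B r)) => √(1 + ‖y‖ ^ 2) := by fun_prop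
  have h := hasChi_norm_eq (K := K) (E := EuclideanSpace ℝ (Σ r, Fin (A r))) hρ
    fun y => by positivity
  rw [finrank_sigma, finrank_sigma] at h
  have hc : IsClosed {p : EuclideanSpace ℝ (Σ r, Fin (A r)) × EuclideanSpace ℝ (Σ r, Fin (B r)) |
    ‖p.1‖ = √(1 + ‖p.2‖ ^ 2)} := isClosed_eq (by fun_prop) (by fun_prop)
  have := hc.locallyCompactSpace
  refine h.of_homeomorph ((quadricHomeomorph k A B).subtype fun p => ?_)
  change MvPolynomial.eval p (poly k A B) = 1 ↔ _ = √_
  rw [eval_poly k A B hk1, eq_comm (a := ‖_‖), Real.sqrt_eq_iff_eq_sq (by positivity)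
    (norm_nonneg _), sub_eq_iff_eq_add, eq_comm]

/-- As for the value 1, with the x and y blocks exchanged. -/
theorem hasChi_fiber_neg_one (hk1 : ∀ r, 1 ≤ k r) : HasChi K (fiber k A B (-1))
    ((-1) ^ (∑ r, A r) - (-1) ^ (∑ r, A r + ∑ r, B r)) := by
  have hρ : Continuous fun x : EuclideanSpace ℝ (Σ r, Fin (A r)) => √(1 + ‖x‖ ^ 2) := by fun_prop
  have h := hasChi_norm_eq (K := K) (E := EuclideanSpace ℝ (Σ r, Fin (B r))) hρ
    fun y => by positivity
  rw [finrank_sigma, finrank_sigma, add_comm (∑ r, B r)] at h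
  have hc : IsClosed {p : EuclideanSpace ℝ (Σ r, Fin (B r)) × EuclideanSpace ℝ (Σ r, Fin (A r)) |
    ‖p.1‖ = √(1 + ‖p.2‖ ^ 2)} := isClosed_eq (by fun_prop) (by fun_prop)
  have := hc.locallyCompactSpace
  refine h.of_homeomorph (((quadricHomeomorph k A B).trans (Homeomorph.prodComm _ _)).subtype
    fun p => ?_)
  change MvPolynomial.eval p (poly k A B) = -1 ↔
    ‖(quadricHomeomorph k A B p).2‖ = √(1 + ‖(quadricHomeomorph k A B p).1‖ ^ 2)
  rw [eval_poly k A B hk1, eq_comm (a := ‖_‖), Real.sqrt_eq_iff_eq_sq (by positivity)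
    (norm_nonneg _)]
  constructor <;> intro h <;> linarith

end Brieskorn

/-! ### Conclusion -/

theorem AlexanderSpanier.HasChi.hasFiniteHc_and_chiC_eq {K : Type*} [Field K] {X : Type*}
    [TopologicalSpace X] {n : ℤ} (h : AlexanderSpanier.HasChi K X n) :
    AlexanderSpanier.HasFiniteHc K X ∧ AlexanderSpanier.chiC K X = n :=
  PairCohomology.HasEuler.of_equiv (B := AlexanderSpanier.Hc K X)
    (AlexanderSpanier.compactCohomologyEquiv K X) h

theorem corollary4p10 (K : Type*) [Field K] (d : ℕ) (hd : 1 ≤ d) (k A B : Fin d → ℕ)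
    (hk : StrictMono k) (hk1 : ∀ r, 1 ≤ k r) (hAB : ∀ r, (A r, B r) ≠ (0, 0))
    (σp σm s : ℕ) (hσp : σp = ∑ r, A r) (hσm : σm = ∑ r, B r) (hs : s = σp + σm) :
    (AlexanderSpanier.HasFiniteHc K (Brieskorn.fiber k A B 0) ∧
      AlexanderSpanier.chiC K (Brieskorn.fiber k A B 0) =
        (-1) ^ (s - 1) + (-1) ^ σp + (-1) ^ σm) ∧
    (AlexanderSpanier.HasFiniteHc K (Brieskorn.fiber k A B 1) ∧
      AlexanderSpanier.chiC K (Brieskorn.fiber k A B 1) = (-1) ^ (s - 1) + (-1) ^ σm) ∧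
    (AlexanderSpanier.HasFiniteHc K (Brieskorn.fiber k A B (-1)) ∧
      AlexanderSpanier.chiC K (Brieskorn.fiber k A B (-1)) = (-1) ^ (s - 1) + (-1) ^ σp) := by
  -- There is at least one variable, so the truncated subtraction s - 1 is genuine and (-1)^(s-1) =
  -- -(-1)^s.
  have hpos : 1 ≤ s := by
    have hr := hAB ⟨0, hd⟩
    have hA : A ⟨0, hd⟩ ≤ σp := hσp ▸ Finset.single_le_sum (fun _ _ => Nat.zero_le _)
      (Finset.mem_univ _)
    have hB : B ⟨0, hd⟩ ≤ σm := hσm ▸ Finset.single_le_sum (fun _ _ => Nat.zero_le _)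
      (Finset.mem_univ _)
    by_contra hc
    exact hr (Prod.ext (by change A _ = 0; omega) (by change B _ = 0; omega))
  have hsign : (-1 : ℤ) ^ (s - 1) = -(-1) ^ (σp + σm) := by
    obtain ⟨s, rfl⟩ := Nat.exists_eq_add_of_le' hpos
    rw [← hs, pow_succ]
    simp
  have h₀ := Brieskorn.hasChi_fiber_zero k A B K hk1
  have h₁ := Brieskorn.hasChi_fiber_one k A B K hk1
  have h₂ := Brieskorn.hasChi_fiber_neg_one k A B K hk1
  rw [← hσp, ← hσm] at h₀ h₁ h₂
  rw [hsign]
  refine ⟨?_, ?_, ?_⟩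
  · convert h₀.hasFiniteHc_and_chiC_eq using 2
    ring
  · convert h₁.hasFiniteHc_and_chiC_eq using 2
    ring
  · convert h₂.hasFiniteHc_and_chiC_eq using 2
    ring
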